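/- Let $M$ be a 3-dimensional smooth manifold and let $\{\mathcal F_\lambda\}_{\lambda\in\mathbb R\cup\{\infty\}}$ be a Veronese web on $M$, i.e. a collection of codimension-one foliations such that near every point there is a smooth local coframe $(\alpha_0,\alpha_1,\alpha_2)$ with $T\mathcal F_\lambda=\ker(\alpha_0+\lambda\alpha_1+\lambda^2\alpha_2)$ for $\lambda\in\mathbb R$ and $T\mathcal F_\infty=\ker\alpha_2$. Consider the following equations for a function $f(x_1,x_2,x_3)$ (subscripts of $f$ denote partial derivatives), each with a family of one-forms $\alpha^\lambda$: (A) $(\lambda_2-\lambda_3)f_{x_1}f_{x_2x_3}+(\lambda_3-\lambda_1)f_{x_2}f_{x_1x_3}+(\lambda_1-\lambda_2)f_{x_3}f_{x_1x_2}=0$, where $\lambda_i=\lambda_i(x_i)$, $\alpha^\lambda=(\lambda_2-\lambda)(\lambda_3-\lambda)f_{x_1}dx_1+(\lambda_3-\lambda)(\lambda_1-\lambda)f_{x_2}dx_2+(\lambda_1-\lambda)(\lambda_2-\lambda)f_{x_3}dx_3$; (B) $f_{x_1}f_{x_1x_3}-f_{x_3}f_{x_1x_1}+(\lambda_2-\lambda_3)(f_{x_1}f_{x_2x_3}-f_{x_2}f_{x_1x_3})+\lambda_2'f_{x_1}f_{x_3}=0$,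 where $\lambda_2=\lambda_2(x_2)$, $\lambda_3=\lambda_3(x_3)$, $\alpha^\lambda=(\lambda_2-\lambda)(\lambda_3-\lambda)(f_{x_1}dx_1+f_{x_2}dx_2)+(\lambda_2-\lambda)^2f_{x_3}dx_3-(\lambda_3-\lambda)f_{x_1}dx_2$; (C) $f_{x_1}f_{x_1x_3}-f_{x_3}f_{x_1x_1}+e^{-\lambda_3'x_2}(f_{x_2}f_{x_1x_2}-f_{x_1}f_{x_2x_2})+\lambda_3''x_2f_{x_1}^2=0$, where $\lambda_3=\lambda_3(x_3)$, $\alpha^\lambda=(\lambda_3-\lambda)^2df-(\lambda_3-\lambda)(e^{\lambda_3'x_2}f_{x_1}dx_2+f_{x_2}dx_3)+e^{\lambda_3'x_2}f_{x_1}dx_3$; (D) $a(f_{x_1}f_{x_2x_3}-f_{x_2}f_{x_1x_3})+b(f_{x_3}f_{x_1x_1}+f_{x_3}f_{x_2x_2}-f_{x_1}f_{x_1x_3}-f_{x_2}f_{x_2x_3})+\lambda_3(f_{x_2}f_{x_1x_3}-f_{x_1}f_{x_2x_3})=0$, where $a=a(x_1,x_2)$, $b=b(x_1,x_2)$, $\lambda_3=\lambda_3(x_3)$,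 $\alpha^\lambda=(\lambda_3-\lambda)\bigl((a-\lambda)(f_{x_1}dx_1+f_{x_2}dx_2)+b(f_{x_1}dx_2-f_{x_2}dx_1)\bigr)+((a-\lambda)^2+b^2)f_{x_3}dx_3$. Consider the following types of equations, where $c_1,c_2,c_3$ are real constants, pairwise different within each type $A_i$, $B_j$, and $c_2\ne0$ for the types $D_2,D_3$: $A_0$: $(\lambda_1,\lambda_2,\lambda_3)=(x_1,x_2,x_3)$; $A_1$: $(x_1,x_2,c_3)$; $A_2$: $(x_1,c_2,c_3)$; $A_3$: $(c_1,c_2,c_3)$; $B_0$: $(\lambda_2,\lambda_3)=(x_2,x_3)$; $B_1$: $(x_2,c_3)$; $B_2$: $(c_2,x_3)$; $B_3$: $(c_2,c_3)$; $C_0$: $\lambda_3=x_3$; $C_1$: $\lambda_3=c_3$; $D_0$: $(a,b,\lambda_3)=(x_1,x_2,x_3)$; $D_1$: $(x_1,x_2,c_3)$; $D_2$: $(c_1,c_2,x_3)$; $D_3$: $(c_1,c_2,c_3)$. A smooth solution $f$ on an open set is called nondegenerate if, writing $\alpha^\lambda=\beta_0+\lambda\beta_1+\lambda^2\beta_2$,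 the one-forms $\beta_0,\beta_1,\beta_2$ are linearly independent at every point of the set. Let $p\in M$ and let $X$ be any of these types, with any admissible constants; if $X$ is one of $D_0,\dots,D_3$, assume in addition that the web is real-analytic near $p$ (i.e. in suitable smooth local coordinates near $p$ the coframe $\alpha_0,\alpha_1,\alpha_2$ can be chosen real-analytic). Then there are smooth local coordinates $(x_1,x_2,x_3)$ on a neighbourhood $U$ of $p$ such that for every open $V\subset U$, every smooth first integral $f$ of $\mathcal F_\infty$ on $V$ (i.e. $T_x\mathcal F_\infty=\ker d_xf$ for all $x\in V$), expressed in these coordinates, is a nondegenerate solution of the equation of type $X$. -/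

import Mathlib

open scoped Manifold ContDiff Topology

noncomputable section

namespace Veronese

/-- Model space for 3-dimensional manifolds. -/
abbrev E3 : Type := EuclideanSpace ℝ (Fin 3)

/-! ### Foliations and Veronese webs -/

section Webs

variable (M : Type*) [TopologicalSpace M] [ChartedSpace E3 M]

/-- A smooth foliation of codimension one on `M`, given by its tangent planes `T_x F`: a field of
planes which near every point is the field of tangent planes to the level surfaces of a smooth
submersion to `ℝ`. -/
structure Foliation where
  /-- the tangent plane `T_x F` to the leaf through `x` -/
  tangent : (x : M) → Submodule ℝ (TangentSpace (𝓡 3) x)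
  exists_submersion : ∀ p : M, ∃ U : Set M, IsOpen U ∧ p ∈ U ∧ ∃ h : M → ℝ,
    ContMDiffOn (𝓡 3) 𝓘(ℝ, ℝ) ∞ h U ∧
    ∀ x ∈ U, mfderiv (𝓡 3) 𝓘(ℝ, ℝ) h x ≠ 0 ∧
      tangent x = (mfderiv (𝓡 3) 𝓘(ℝ, ℝ) h x).ker

variable {M}

/-- `f` is a (smooth, regular) first integral of the foliation `F` on the open set `V`:
`T_x F = ker d_x f` for all `x ∈ V`. -/
def Foliation.IsFirstIntegralOn (F : Foliation M) (f : M → ℝ) (V : Set M) : Prop :=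
  ContMDiffOn (𝓡 3) 𝓘(ℝ, ℝ) ∞ f V ∧
    ∀ x ∈ V, F.tangent x = (mfderiv (𝓡 3) 𝓘(ℝ, ℝ) f x).ker

/-- Let `φ` be a chart of `M` and `α 0, α 1, α 2` three one-forms on its target, i.e. one-forms on
the source of `φ` written in the coordinates `φ`. They are said to be a Veronese coframe of class
`C^k` (where `k = ∞` for smooth and `k = ω` for real-analytic) for a family of foliations `F_t`,
`t ∈ ℝ ∪ {∞}`, if they are of class `C^k`, are linearly independent at every point, and the
tangent planes of `F_t` and `F_∞` are the kernels of the (pulled back) one-forms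
`α 0 + t α 1 + t² α 2` and `α 2`. -/
structure IsVeroneseCoframe (k : WithTop ℕ∞) (F : OnePoint ℝ → Foliation M)
    (φ : OpenPartialHomeomorph M E3) (α : Fin 3 → E3 → (E3 →L[ℝ] ℝ)) : Prop where
  contDiffOn : ∀ i, ContDiffOn ℝ k (α i) φ.target
  linearIndependent : ∀ y ∈ φ.target, LinearIndependent ℝ (fun i => α i y)
  tangent_coe : ∀ x ∈ φ.source, ∀ t : ℝ, (F (t : OnePoint ℝ)).tangent x =
    ((α 0 (φ x) + t • α 1 (φ x) + t ^ 2 • α 2 (φ x)).comp (mfderiv (𝓡 3) (𝓡 3) φ x)).ker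
  tangent_infty : ∀ x ∈ φ.source, (F OnePoint.infty).tangent x =
    ((α 2 (φ x)).comp (mfderiv (𝓡 3) (𝓡 3) φ x)).ker

/-- Near `p` there are smooth local coordinates on `M` in which the family `F_t` has a Veronese
coframe of class `C^k`. -/
def HasVeroneseCoframeAt (k : WithTop ℕ∞) (F : OnePoint ℝ → Foliation M) (p : M) : Prop :=
  ∃ φ ∈ IsManifold.maximalAtlas (𝓡 3) ∞ M, p ∈ φ.source ∧
    ∃ α : Fin 3 → E3 → (E3 →L[ℝ] ℝ), IsVeroneseCoframe k F φ α

variable (M) in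
/-- A Veronese web on a 3-dimensional manifold: a collection of codimension one foliations
parametrized by the real projective line `ℝ ∪ {∞}`, with a smooth Veronese coframe near every
point. -/
structure Web where
  foliation : OnePoint ℝ → Foliation M
  exists_coframe : ∀ p : M, HasVeroneseCoframeAt ∞ foliation p

/-- The Veronese web is real-analytic near `p`: in suitable local coordinates it has a
real-analytic Veronese coframe. -/
def Web.IsAnalyticNear (W : Web M) (p : M) : Prop :=
  HasVeroneseCoframeAt ω W.foliation p

end Webs

/-! ### The equations A, B, C, D -/

/-- Partial derivative `∂f/∂x_{i+1}` (the coordinates `x₁, x₂, x₃` are numbered by `0, 1, 2`). -/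
def pd (i : Fin 3) (f : E3 → ℝ) (x : E3) : ℝ :=
  fderiv ℝ f x (EuclideanSpace.single i 1)

/-- The equations of the four families, with their functional parameters: `A l₁ l₂ l₃`, `B l₂ l₃`,
`C l₃` with `lᵢ = lᵢ(xᵢ)`, and `D a b l₃` with `a, b` functions of `(x₁, x₂)`. -/
inductive Equation where
  | A (l₁ l₂ l₃ : ℝ → ℝ)
  | B (l₂ l₃ : ℝ → ℝ)
  | C (l₃ : ℝ → ℝ)
  | D (a b : ℝ → ℝ → ℝ) (l₃ : ℝ → ℝ)

/-- The left hand side of the equation (whose right hand side is zero) for the function `f` at the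
point `x`. -/
def Equation.lhs (Q : Equation) (f : E3 → ℝ) (x : E3) : ℝ :=
  let x₁ := x 0
  let x₂ := x 1
  let x₃ := x 2
  let f₁ := pd 0 f x
  let f₂ := pd 1 f x
  let f₃ := pd 2 f x
  let f₁₁ := pd 0 (pd 0 f) x
  let f₁₂ := pd 1 (pd 0 f) x
  let f₁₃ := pd 2 (pd 0 f) x
  let f₂₂ := pd 1 (pd 1 f) x
  let f₂₃ := pd 2 (pd 1 f) x
  match Q with
  | A l₁ l₂ l₃ =>
      (l₂ x₂ - l₃ x₃) * f₁ * f₂₃ + (l₃ x₃ - l₁ x₁) * f₂ * f₁₃ + (l₁ x₁ - l₂ x₂) * f₃ * f₁₂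
  | B l₂ l₃ =>
      f₁ * f₁₃ - f₃ * f₁₁ + (l₂ x₂ - l₃ x₃) * (f₁ * f₂₃ - f₂ * f₁₃) + deriv l₂ x₂ * f₁ * f₃
  | C l₃ =>
      f₁ * f₁₃ - f₃ * f₁₁ + Real.exp (-(deriv l₃ x₃ * x₂)) * (f₂ * f₁₂ - f₁ * f₂₂)
        + deriv (deriv l₃) x₃ * x₂ * f₁ ^ 2
  | D a b l₃ =>
      a x₁ x₂ * (f₁ * f₂₃ - f₂ * f₁₃) + b x₁ x₂ * (f₃ * f₁₁ + f₃ * f₂₂ - f₁ * f₁₃ - f₂ * f₂₃)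
        + l₃ x₃ * (f₂ * f₁₃ - f₁ * f₂₃)

/-- The one-form `α^t` at the point `x` that belongs to the equation and the function `f`, given by
its components with respect to `dx₁, dx₂, dx₃`. -/
def Equation.form (Q : Equation) (f : E3 → ℝ) (t : ℝ) (x : E3) : Fin 3 → ℝ :=
  let x₁ := x 0
  let x₂ := x 1
  let x₃ := x 2
  let f₁ := pd 0 f x
  let f₂ := pd 1 f x
  let f₃ := pd 2 f x
  match Q with
  | A l₁ l₂ l₃ =>
      ![(l₂ x₂ - t) * (l₃ x₃ - t) * f₁,
        (l₃ x₃ - t) * (l₁ x₁ - t) * f₂,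
        (l₁ x₁ - t) * (l₂ x₂ - t) * f₃]
  | B l₂ l₃ =>
      ![(l₂ x₂ - t) * (l₃ x₃ - t) * f₁,
        (l₂ x₂ - t) * (l₃ x₃ - t) * f₂ - (l₃ x₃ - t) * f₁,
        (l₂ x₂ - t) ^ 2 * f₃]
  | C l₃ =>
      ![(l₃ x₃ - t) ^ 2 * f₁,
        (l₃ x₃ - t) ^ 2 * f₂ - (l₃ x₃ - t) * Real.exp (deriv l₃ x₃ * x₂) * f₁,
        (l₃ x₃ - t) ^ 2 * f₃ - (l₃ x₃ - t) * f₂ + Real.exp (deriv l₃ x₃ * x₂) * f₁]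
  | D a b l₃ =>
      ![(l₃ x₃ - t) * ((a x₁ x₂ - t) * f₁ - b x₁ x₂ * f₂),
        (l₃ x₃ - t) * ((a x₁ x₂ - t) * f₂ + b x₁ x₂ * f₁),
        ((a x₁ x₂ - t) ^ 2 + b x₁ x₂ ^ 2) * f₃]

/-- `f` is a smooth solution of the equation on the open set `U`. -/
def Equation.IsSolutionOn (Q : Equation) (f : E3 → ℝ) (U : Set E3) : Prop :=
  ContDiffOn ℝ ∞ f U ∧ ∀ x ∈ U, Q.lhs f x = 0

/-- `f` is a nondegenerate solution on the open set `U`: the one-forms `β 0, β 1, β 2` in the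
decomposition `α^t = β 0 + t β 1 + t² β 2` are linearly independent at every point of `U`. -/
def Equation.IsNondegenerateSolutionOn (Q : Equation) (f : E3 → ℝ) (U : Set E3) : Prop :=
  Q.IsSolutionOn f U ∧ ∀ x ∈ U, ∃ β : Fin 3 → (Fin 3 → ℝ), LinearIndependent ℝ β ∧
    ∀ t : ℝ, Q.form f t x = β 0 + t • β 1 + t ^ 2 • β 2

/-- The types `A₀, …, A₃, B₀, …, B₃, C₀, C₁, D₀, …, D₃`, with their constants: the constants that
occur in one type A or B are pairwise different, and `c₂ ≠ 0` for type D. -/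
inductive EqType where
  | A0
  | A1 (c₃ : ℝ)
  | A2 (c₂ c₃ : ℝ) (h : c₂ ≠ c₃)
  | A3 (c₁ c₂ c₃ : ℝ) (h₁₂ : c₁ ≠ c₂) (h₁₃ : c₁ ≠ c₃) (h₂₃ : c₂ ≠ c₃)
  | B0
  | B1 (c₃ : ℝ)
  | B2 (c₂ : ℝ)
  | B3 (c₂ c₃ : ℝ) (h : c₂ ≠ c₃)
  | C0
  | C1 (c₃ : ℝ)
  | D0
  | D1 (c₃ : ℝ)
  | D2 (c₁ c₂ : ℝ) (h : c₂ ≠ 0)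
  | D3 (c₁ c₂ c₃ : ℝ) (h : c₂ ≠ 0)

/-- The equation of the given type. -/
def EqType.equation : EqType → Equation
  | A0 => .A (fun s => s) (fun s => s) (fun s => s)
  | A1 c₃ => .A (fun s => s) (fun s => s) (fun _ => c₃)
  | A2 c₂ c₃ _ => .A (fun s => s) (fun _ => c₂) (fun _ => c₃)
  | A3 c₁ c₂ c₃ _ _ _ => .A (fun _ => c₁) (fun _ => c₂) (fun _ => c₃)
  | B0 => .B (fun s => s) (fun s => s)
  | B1 c₃ => .B (fun s => s) (fun _ => c₃)
  | B2 c₂ => .B (fun _ => c₂) (fun s => s)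
  | B3 c₂ c₃ _ => .B (fun _ => c₂) (fun _ => c₃)
  | C0 => .C (fun s => s)
  | C1 c₃ => .C (fun _ => c₃)
  | D0 => .D (fun s _ => s) (fun _ s => s) (fun s => s)
  | D1 c₃ => .D (fun s _ => s) (fun _ s => s) (fun _ => c₃)
  | D2 c₁ c₂ _ => .D (fun _ _ => c₁) (fun _ _ => c₂) (fun s => s)
  | D3 c₁ c₂ c₃ _ => .D (fun _ _ => c₁) (fun _ _ => c₂) (fun _ => c₃)

/-- The type is one of `D₀, D₁, D₂, D₃`. -/
def EqType.IsTypeD : EqType → Prop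
  | D0 => True
  | D1 _ => True
  | D2 _ _ _ => True
  | D3 _ _ _ _ => True
  | _ => False

end Veronese

end

/-! Every form $\alpha^t=\alpha_0+t\alpha_1+t^2\alpha_2$ is integrable, and a quadratic polynomial
in $t$ is determined by its values at three nodes, counted with multiplicity and possibly complex.
The four families of equations are the four node patterns: three distinct real nodes (A), a double
and a simple one (B), a triple one (C), a conjugate pair and a real one (D). A node is either
constant or varies with the point.

Each node $l$ needs a function $\chi$ with $\alpha^{l(\chi)}=m\,d\chi$. The Frobenius theorem with a
parameter (`exists_firstIntegral`) gives $\alpha^t=G\,d_xF$ with $F,G$ smooth in $(t,x)$ and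
$F(t,p)=0$ for all $t$ near the given $t_0$. For a constant node, $\chi=F(t_0,\cdot)$. For a moving
node, $\chi$ solves $F(\chi(x),x)=\chi(x)-t_0$; differentiation gives $d_xF=(1-F_t)\,d\chi$ at
$t=\chi(x)$, so $\chi$ is the node and the coordinate at once. At a multiple node the
$t$-derivatives of $\alpha^t=G\,d_xF$ supply the missing coordinates (`exists_eigenfunction_jets`).
Interpolation then shows that, in these coordinates, $\alpha^t$ is the form $\alpha^\lambda$ of the
equation with a vector $g$ in place of the gradient of $f$, and $g$ consists of the components of
$\alpha_2$.

A first integral $f$ of $\mathcal F_\infty$ has $df=k\alpha_2$ with $k\ne0$, so the form that the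
equation attaches to $f$ is $k\alpha^t$, which is integrable. Its $\alpha\wedge d\alpha$ is the left
hand side of the equation times a factor that is nonzero for $t$ off the nodes (`equationA_curl` and
its analogues), so $f$ is a solution; it is nondegenerate because the $\alpha_i$ are independent
(`isNondegenerateSolutionOn_of_chart`).

For type D the analytic coefficients are extended to $\mathbb C^3$, integrability follows there by
the identity theorem, and a complex node yields a holomorphic $\chi$ whose real and imaginary parts
on real points are the coordinates $x_1,x_2$. For this reason the Frobenius theorem is proved over
$\mathbb R$ and $\mathbb C$ together: paths inside a leaf are found by the implicit function theorem
in a space of continuous functions on $[0,1]$, which gives smooth dependence on all data. -/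

noncomputable section

namespace Veronese

/-! ### Smoothness of composition operators -/

section Superposition

universe u

variable {𝕜 : Type*} [RCLike 𝕜] {I : Type*} [TopologicalSpace I]
variable {E F : Type u} [NormedAddCommGroup E] [NormedSpace 𝕜 E]
  [NormedAddCommGroup F] [NormedSpace 𝕜 F]

open Classical in
/-- The superposition operator `γ ↦ f ∘ γ` on continuous maps (with value `0` where `f ∘ γ` is not
continuous). -/
def superpose (f : E → F) (γ : C(I, E)) : C(I, F) :=
  if h : Continuous (f ∘ γ) then ⟨f ∘ γ, h⟩ else 0

theorem superpose_apply {f : E → F} {U : Set E} (hU : IsOpen U) (hf : ContinuousOn f U)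
    {γ : C(I, E)} (hγ : ∀ s, γ s ∈ U) (s : I) : superpose f γ s = f (γ s) := by
  have h : Continuous (f ∘ γ) := continuous_iff_continuousAt.2 fun s =>
    (hf.continuousAt (hU.mem_nhds (hγ s))).comp γ.continuous.continuousAt
  simp [superpose, h]

variable [CompactSpace I]

theorem isOpen_setOf_forall_mem {U : Set E} (hU : IsOpen U) :
    IsOpen {γ : C(I, E) | ∀ s, γ s ∈ U} := by
  have := ContinuousMap.isOpen_setOfPred_mapsTo (X := I) (Y := E) isCompact_univ hU
  simpa [Set.MapsTo] using this

/-- Pointwise application of a family of continuous linear maps. -/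
def pointwiseApply : C(I, E →L[𝕜] F) →L[𝕜] C(I, E) →L[𝕜] C(I, F) :=
  LinearMap.mkContinuous₂
    (LinearMap.mk₂ 𝕜 (fun (A : C(I, E →L[𝕜] F)) (h : C(I, E)) =>
      (⟨fun s => A s (h s), by fun_prop⟩ : C(I, F)))
      (fun _ _ _ => by ext; simp) (fun _ _ _ => by ext; simp)
      (fun _ _ _ => by ext; simp) (fun _ _ _ => by ext; simp)) 1
    (fun A h => by
      rw [one_mul, ContinuousMap.norm_le _ (by positivity)]
      intro s
      exact ((A s).le_opNorm _).trans
        (by gcongr <;> exact ContinuousMap.norm_coe_le_norm _ _))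

@[simp]
theorem pointwiseApply_apply (A : C(I, E →L[𝕜] F)) (h : C(I, E)) (s : I) :
    pointwiseApply A h s = A s (h s) := rfl

/-- The range of `γ` is compact, so a single `δ` serves all `s`; this is what turns pointwise
estimates into estimates in the sup norm. -/
theorem exists_uniform_nhd {F : Type*} [PseudoMetricSpace F]
    {f : E → F} {U : Set E} (hU : IsOpen U) (hf : ContinuousOn f U)
    {γ : C(I, E)} (hγ : ∀ s, γ s ∈ U) {ε : ℝ} (hε : 0 < ε) :
    ∃ δ > 0, ∀ s, ∀ y, dist (γ s) y < δ → y ∈ U ∧ dist (f (γ s)) (f y) < ε := by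
  have hK : IsCompact (Set.range γ) := isCompact_range γ.continuous
  have hKU : Set.range γ ⊆ U := by rintro _ ⟨s, rfl⟩; exact hγ s
  have h1 := hK.uniformContinuousAt_of_continuousAt f
    (fun a ha => hf.continuousAt (hU.mem_nhds (hKU ha))) (Metric.dist_mem_uniformity hε)
  obtain ⟨δ₁, h₁, h₁'⟩ := Metric.mem_uniformity_dist.1 h1
  obtain ⟨δ₂, h₂, h₂'⟩ := hK.exists_thickening_subset_open hU hKU
  refine ⟨min δ₁ δ₂, lt_min h₁ h₂, fun s y hy => ⟨h₂' ?_, ?_⟩⟩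
  · rw [Metric.mem_thickening_iff]
    exact ⟨γ s, ⟨s, rfl⟩, by rw [dist_comm]; exact hy.trans_le (min_le_right _ _)⟩
  · exact h₁' (hy.trans_le (min_le_left _ _)) ⟨s, rfl⟩

theorem continuousOn_superpose {f : E → F} {U : Set E} (hU : IsOpen U) (hf : ContinuousOn f U) :
    ContinuousOn (superpose (I := I) f) {γ | ∀ s, γ s ∈ U} := by
  intro γ hγ
  refine ContinuousAt.continuousWithinAt (Metric.continuousAt_iff.2 fun ε hε => ?_)
  obtain ⟨δ, hδ, h⟩ := exists_uniform_nhd hU hf hγ (half_pos hε)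
  refine ⟨δ, hδ, fun {η} hη => ?_⟩
  have hd : ∀ s, dist (γ s) (η s) < δ := fun s =>
    (ContinuousMap.dist_apply_le_dist s).trans_lt (by rwa [dist_comm])
  refine lt_of_le_of_lt ((ContinuousMap.dist_le (half_pos hε).le).2 fun s => ?_) (half_lt_self hε)
  rw [superpose_apply hU hf hγ, superpose_apply hU hf fun s => (h s _ (hd s)).1, dist_comm]
  exact (h s _ (hd s)).2.le

/-- By the mean value inequality on balls around the points `γ s`, the remainder is controlled by
the oscillation of `fderiv 𝕜 f`, which is uniformly small near the range of `γ`. -/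
theorem hasFDerivAt_superpose {f : E → F} {U : Set E} (hU : IsOpen U)
    (hf : ContDiffOn 𝕜 1 f U) {γ : C(I, E)} (hγ : ∀ s, γ s ∈ U) :
    HasFDerivAt (superpose f) (pointwiseApply (superpose (fderiv 𝕜 f) γ)) γ := by
  have hc : ContinuousOn (fderiv 𝕜 f) U := hf.continuousOn_fderiv_of_isOpen hU le_rfl
  rw [hasFDerivAt_iff_isLittleO, Asymptotics.isLittleO_iff]
  intro ε hε
  obtain ⟨δ, hδ, h⟩ := exists_uniform_nhd hU hc hγ hε
  filter_upwards [Metric.ball_mem_nhds γ hδ] with η hη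
  have hd : ∀ s, dist (γ s) (η s) < δ := fun s =>
    (ContinuousMap.dist_apply_le_dist s).trans_lt (by rw [dist_comm]; exact hη)
  rw [ContinuousMap.norm_le _ (by positivity)]
  intro s
  have hs : ‖f (η s) - f (γ s) - fderiv 𝕜 f (γ s) (η s - γ s)‖ ≤ ε * ‖η s - γ s‖ := by
    let _ : NormedSpace ℝ E := NormedSpace.restrictScalars ℝ 𝕜 E
    refine (convex_ball (γ s) δ).norm_image_sub_le_of_norm_fderiv_le' (𝕜 := 𝕜) (f := f)
      (fun y hy => ?_) (fun y hy => ?_) (Metric.mem_ball_self hδ)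
      (by rw [Metric.mem_ball, dist_comm]; exact hd s)
    · have hy' := (h s y (by rw [dist_comm]; exact hy)).1
      exact (hf.differentiableOn one_ne_zero).differentiableAt (hU.mem_nhds hy')
    · have hy' := (h s y (by rw [dist_comm]; exact hy)).2.le
      rwa [dist_comm, dist_eq_norm] at hy'
  simp only [ContinuousMap.sub_apply, pointwiseApply_apply]
  rw [superpose_apply hU hf.continuousOn hγ, superpose_apply hU hc hγ,
    superpose_apply hU hf.continuousOn fun s => (h s _ (hd s)).1]
  exact hs.trans (mul_le_mul_of_nonneg_left ((η - γ).norm_coe_le_norm s) hε.le)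

/-- The derivative of a superposition operator is the superposition operator of `fderiv 𝕜 f`
followed by a bounded linear map, so the induction gains one order. The codomain varies in the
induction because `f` is replaced by its derivative. -/
theorem contDiffOn_superpose_nat (n : ℕ) : ∀ {F : Type u} [NormedAddCommGroup F] [NormedSpace 𝕜 F]
    {f : E → F} {U : Set E} (_ : IsOpen U) (_ : ContDiffOn 𝕜 n f U),
    ContDiffOn 𝕜 n (superpose (I := I) f) {γ | ∀ s, γ s ∈ U} := by
  induction n with
  | zero =>
    intro F _ _ f U hU hf
    rw [Nat.cast_zero, contDiffOn_zero] at *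
    exact continuousOn_superpose hU hf
  | succ n ih =>
    intro F _ _ f U hU hf
    have hO := isOpen_setOf_forall_mem (I := I) hU
    have h1 : ContDiffOn 𝕜 1 f U := hf.of_le (by simp)
    rw [Nat.cast_add, Nat.cast_one, contDiffOn_succ_iff_fderiv_of_isOpen hU] at hf
    rw [Nat.cast_add, Nat.cast_one, contDiffOn_succ_iff_fderiv_of_isOpen hO]
    refine ⟨fun γ hγ => (hasFDerivAt_superpose hU h1 hγ).differentiableAt.differentiableWithinAt,
      fun h => absurd h (by simp), ?_⟩
    refine ((pointwiseApply (𝕜 := 𝕜) (I := I) (E := E) (F := F)).contDiff.comp_contDiffOn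
      (ih hU hf.2.2)).congr fun γ hγ => ?_
    exact (hasFDerivAt_superpose hU h1 hγ).fderiv

theorem contDiffOn_superpose {f : E → F} {U : Set E} (hU : IsOpen U) (hf : ContDiffOn 𝕜 ∞ f U) :
    ContDiffOn 𝕜 ∞ (superpose (I := I) f) {γ | ∀ s, γ s ∈ U} :=
  contDiffOn_infty.2 fun n => contDiffOn_superpose_nat n hU (contDiffOn_infty.1 hf n)

end Superposition

/-! ### Inverse and implicit functions that are smooth near a point -/

section Implicit

variable {𝕜 : Type*} [RCLike 𝕜]
variable {E F : Type*} [NormedAddCommGroup E] [NormedSpace 𝕜 E] [CompleteSpace E]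
  [NormedAddCommGroup F] [NormedSpace 𝕜 F]

/-- Invertible linear maps form an open set, so the source can be shrunk to points with invertible
derivative; the inverse is then smooth on the whole target, not only at the image of `a`. -/
theorem exists_openPartialHomeomorph_of_smooth {f : E → F} {a : E}
    (hf : ∀ᶠ x in 𝓝 a, ContDiffAt 𝕜 ∞ f x) {f' : E ≃L[𝕜] F} (hf' : HasFDerivAt f (f' : E →L[𝕜] F) a)
    {s : Set E} (hs : s ∈ 𝓝 a) :
    ∃ e : OpenPartialHomeomorph E F, a ∈ e.source ∧ e.source ⊆ s ∧ (∀ x, e x = f x) ∧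
      (∀ x ∈ e.source, ContDiffAt 𝕜 ∞ f x) ∧ ∀ y ∈ e.target, ContDiffAt 𝕜 ∞ e.symm y := by
  have ha := hf.self_of_nhds
  have hinv : ∀ᶠ x in 𝓝 a, ∃ L : E ≃L[𝕜] F, (L : E →L[𝕜] F) = fderiv 𝕜 f x := by
    have hc : ContinuousAt (fderiv 𝕜 f) a := (ha.fderiv_right (m := 0) (by simp)).continuousAt
    have := hc.preimage_mem_nhds (t := Set.range ((↑) : (E ≃L[𝕜] F) → (E →L[𝕜] F)))
      (by rw [hf'.fderiv]; exact ContinuousLinearEquiv.nhds f')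
    exact this
  obtain ⟨u, hu, huo, hau⟩ := eventually_nhds_iff.1 ((hf.and hinv).and hs)
  set e₀ := ha.toOpenPartialHomeomorph f hf' (by simp)
  refine ⟨e₀.restrOpen u huo, ⟨ha.mem_toOpenPartialHomeomorph_source hf' (by simp), hau⟩,
    fun x hx => (hu x hx.2).2, fun x => rfl, fun x hx => (hu x hx.2).1.1, fun y hy => ?_⟩
  set e := e₀.restrOpen u huo
  have hx : e.symm y ∈ u := (e.map_target hy).2
  obtain ⟨⟨h1, L, hL⟩, -⟩ := hu _ hx
  refine e.contDiffAt_symm (f₀' := L) hy ?_ h1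
  rw [hL]
  exact (h1.differentiableAt (by simp)).hasFDerivAt

/-- The map $(x,y)\mapsto(x,H(x,y))$ has a shear as its derivative at the base point, hence a smooth
local inverse. It is applied with `F` a space of continuous functions and with `F` the scalar field.
-/
theorem exists_implicit_of_smooth [CompleteSpace F] {H : E × F → F} {q : E} {y : F}
    (hH : ∀ᶠ z in 𝓝 (q, y), ContDiffAt 𝕜 ∞ H z) (hy : ∀ v, fderiv 𝕜 H (q, y) (0, v) = v) :
    ∃ g : E → F, (∀ᶠ x in 𝓝 q, ContDiffAt 𝕜 ∞ g x) ∧ g q = y ∧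
      ∀ᶠ x in 𝓝 q, H (x, g x) = H (q, y) := by
  set A : E →L[𝕜] F := (fderiv 𝕜 H (q, y)).comp (ContinuousLinearMap.inl 𝕜 E F)
  let L : (E × F) ≃L[𝕜] (E × F) := ContinuousLinearEquiv.equivOfInverse
    ((ContinuousLinearMap.fst 𝕜 E F).prod
      (A.comp (ContinuousLinearMap.fst 𝕜 E F) + ContinuousLinearMap.snd 𝕜 E F))
    ((ContinuousLinearMap.fst 𝕜 E F).prod
      (ContinuousLinearMap.snd 𝕜 E F - A.comp (ContinuousLinearMap.fst 𝕜 E F)))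
    (fun x => by simp) (fun x => by simp)
  have hL : HasFDerivAt (fun z : E × F => (z.1, H z)) (L : (E × F) →L[𝕜] (E × F)) (q, y) := by
    have h := (hasFDerivAt_fst (𝕜 := 𝕜) (p := (q, y))).prodMk
      (hH.self_of_nhds.differentiableAt (by simp)).hasFDerivAt
    have hLe : (L : (E × F) →L[𝕜] (E × F)) =
        (ContinuousLinearMap.fst 𝕜 E F).prod (fderiv 𝕜 H (q, y)) := by
      refine ContinuousLinearMap.ext fun v => Prod.ext rfl ?_
      change fderiv 𝕜 H (q, y) (v.1, 0) + v.2 = fderiv 𝕜 H (q, y) v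
      conv_lhs => rw [← hy v.2, ← map_add]
      simp
    rw [hLe]
    exact h
  obtain ⟨e, he, -, hef, -, hes⟩ := exists_openPartialHomeomorph_of_smooth
    (hH.mono fun z hz => contDiffAt_fst.prodMk hz) hL Filter.univ_mem
  have hq : e (q, y) = (q, H (q, y)) := hef _
  have ht : ∀ᶠ x in 𝓝 q, (x, H (q, y)) ∈ e.target := by
    have h1 : ContinuousAt (fun x : E => (x, H (q, y))) q := by fun_prop
    exact h1.preimage_mem_nhds (e.open_target.mem_nhds (hq ▸ e.map_source he))
  refine ⟨fun x => (e.symm (x, H (q, y))).2, ?_, ?_, ?_⟩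
  · filter_upwards [ht] with x hx
    exact contDiffAt_snd.comp x ((hes _ hx).comp x (contDiffAt_id.prodMk contDiffAt_const))
  · simp only [← hq, e.left_inv he]
  · filter_upwards [ht] with x hx
    have h := e.right_inv hx
    rw [hef] at h
    have h1 : (e.symm (x, H (q, y))).1 = x := congrArg Prod.fst h
    have h2 : H (e.symm (x, H (q, y))) = H (q, y) := congrArg Prod.snd h
    have hp : (x, (e.symm (x, H (q, y))).2) = e.symm (x, H (q, y)) := Prod.ext h1.symm rfl
    exact (congrArg H hp).trans h2

end Implicit

/-! ### The Frobenius theorem with a parameter -/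

section Frobenius

universe u

variable {𝕜 : Type u} [RCLike 𝕜] {E : Type u} [NormedAddCommGroup E] [NormedSpace 𝕜 E]

theorem fderiv_apply_apply {E' F' : Type*} [NormedAddCommGroup E'] [NormedSpace 𝕜 E']
    [NormedAddCommGroup F'] [NormedSpace 𝕜 F'] {θ : E' → F' →L[𝕜] 𝕜} {q : E'}
    (hθ : DifferentiableAt 𝕜 θ q) (e : F') (w : E') :
    fderiv 𝕜 (fun q => θ q e) q w = fderiv 𝕜 θ q w e := by
  have h := (hθ.hasFDerivAt.clm_apply (hasFDerivAt_const e q)).fderiv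
  rw [h]
  simp

/-- The curve `γ` runs in a leaf, since $\gamma'=-\xi+\theta(\xi)e$ and $\theta(e)=1$. Moving its
starting point along `v` varies it by $(1-s)v+\eta e$. Let $\kappa=(1-s)\theta(v)+\eta$ be the value
of $\theta$ on this variation. Integrability, applied to $\gamma'$ and to the variation minus
$\kappa e$, leaves the linear equation $\kappa'=\kappa\,(\partial_e\theta)(\xi)$. As $\kappa(0)=0$,
a Grönwall argument gives $\kappa=0$, and $\kappa(1)=\eta(1)$. -/
theorem eq_zero_of_leaf_variation {Ω : Set (𝕜 × E)} (hΩ : IsOpen Ω) {θ : 𝕜 × E → E →L[𝕜] 𝕜}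
    (hθ : ContDiffOn 𝕜 1 θ Ω) {e : E} (he : ∀ q ∈ Ω, θ q e = 1)
    (hint : ∀ q ∈ Ω, ∀ u v, θ q u = 0 → θ q v = 0 →
      fderiv 𝕜 θ q (0, u) v = fderiv 𝕜 θ q (0, v) u)
    {t : 𝕜} {y η : ℝ → 𝕜} {p ξ v : E} {γ : ℝ → E}
    (hγ : ∀ s, γ s = p + ((1 - s : ℝ) : 𝕜) • ξ + y s • e)
    (hmem : ∀ s ∈ Set.Icc (0 : ℝ) 1, (t, γ s) ∈ Ω)
    (hy : ∀ s ∈ Set.Icc (0 : ℝ) 1, HasDerivAt y (θ (t, γ s) ξ) s)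
    (hη : ∀ s ∈ Set.Icc (0 : ℝ) 1, HasDerivAt η
      (fderiv 𝕜 θ (t, γ s) (0, ((1 - s : ℝ) : 𝕜) • v + η s • e) ξ + θ (t, γ s) v) s)
    (hη0 : η 0 = 0) (hv : θ (t, γ 0) v = 0) : η 1 = 0 := by
  let _ : NormedSpace ℝ E := NormedSpace.restrictScalars ℝ 𝕜 E
  have _ : IsScalarTower ℝ 𝕜 E := RestrictScalars.isScalarTower ℝ 𝕜 E
  have hdiff : ∀ q ∈ Ω, DifferentiableAt 𝕜 θ q := fun q hq =>
    (hθ.differentiableOn one_ne_zero).differentiableAt (hΩ.mem_nhds hq)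
  have hDe : ∀ q ∈ Ω, ∀ w, fderiv 𝕜 θ q w e = 0 := fun q hq w => by
    rw [← fderiv_apply_apply (hdiff q hq)]
    have : (fun q => θ q e) =ᶠ[𝓝 q] fun _ => 1 := by
      filter_upwards [hΩ.mem_nhds hq] with r hr using he r hr
    rw [this.fderiv_eq]
    simp
  have hof : ∀ s : ℝ, HasDerivAt (fun s : ℝ => ((1 - s : ℝ) : 𝕜)) (-1) s := fun s => by
    have h := (RCLike.ofRealCLM (K := 𝕜)).hasFDerivAt.comp_hasDerivAt s
      ((hasDerivAt_id s).const_sub 1)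
    simpa [Function.comp_def] using h
  have hγ' : ∀ s ∈ Set.Icc (0 : ℝ) 1, HasDerivAt γ (-ξ + θ (t, γ s) ξ • e) s := fun s hs => by
    rw [show γ = fun s => p + ((1 - s : ℝ) : 𝕜) • ξ + y s • e from funext hγ] at hy ⊢
    have h := (((hof s).smul_const ξ).const_add p).add ((hy s hs).smul_const e)
    exact h.congr_deriv (by simp)
  have hc : ∀ s ∈ Set.Icc (0 : ℝ) 1,
      HasDerivAt (fun s => (t, γ s)) ((0 : 𝕜), -ξ + θ (t, γ s) ξ • e) s := fun s hs =>
    (hasDerivAt_const s t).prodMk (hγ' s hs)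
  have hθc : ∀ s ∈ Set.Icc (0 : ℝ) 1, HasDerivAt (fun s => θ (t, γ s) v)
      (fderiv 𝕜 θ (t, γ s) (0, -ξ + θ (t, γ s) ξ • e) v) s := fun s hs => by
    have h1 : HasFDerivAt (fun q => θ q v) (fderiv 𝕜 (fun q => θ q v) (t, γ s)) (t, γ s) :=
      ((hdiff _ (hmem s hs)).clm_apply (differentiableAt_const v)).hasFDerivAt
    have h2 := (h1.restrictScalars ℝ).comp_hasDerivAt s (hc s hs)
    exact h2.congr_deriv (by simp [fderiv_apply_apply (hdiff _ (hmem s hs))])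
  have hκ : ∀ s ∈ Set.Icc (0 : ℝ) 1, HasDerivAt
      (fun s => ((1 - s : ℝ) : 𝕜) * θ (t, γ s) v + η s)
      ((((1 - s : ℝ) : 𝕜) * θ (t, γ s) v + η s) * fderiv 𝕜 θ (t, γ s) (0, e) ξ) s := fun s hs => by
    have h := ((hof s).mul (hθc s hs)).add (hη s hs)
    refine h.congr_deriv ?_
    have hq := hmem s hs
    have h1 := hint _ hq (-ξ + θ (t, γ s) ξ • e)
      (((1 - s : ℝ) : 𝕜) • v + η s • e - (((1 - s : ℝ) : 𝕜) * θ (t, γ s) v + η s) • e)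
      (by simp [he _ hq]) (by simp [he _ hq])
    have hz : ∀ a b : E, ((0 : 𝕜), a + b) = (0, a) + (0, b) := by simp
    have hs : ∀ (c : 𝕜) (a : E), ((0 : 𝕜), c • a) = c • (0, a) := by simp
    simp only [sub_eq_add_neg, ← neg_smul, map_add, map_neg, map_smul, hz, hs, hDe _ hq,
      smul_eq_mul, mul_zero, add_zero, add_apply,
      smul_apply] at h1 ⊢
    linear_combination h1
  have hcont : ContinuousOn (fun s => fderiv 𝕜 θ (t, γ s) (0, e) ξ) (Set.Icc 0 1) := by
    have h1 := (hθ.continuousOn_fderiv_of_isOpen hΩ le_rfl).comp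
      (fun s hs => (hc s hs).continuousAt.continuousWithinAt) hmem
    exact (h1.clm_apply continuousOn_const).clm_apply continuousOn_const
  obtain ⟨K, hK⟩ := isCompact_Icc.exists_bound_of_continuousOn hcont
  have h := eq_zero_of_abs_deriv_le_mul_abs_self_of_eq_zero_right (K := K)
    (fun s hs => (hκ s hs).continuousAt.continuousWithinAt)
    (fun s hs => (hκ s ⟨hs.1, hs.2.le⟩).hasDerivWithinAt) (by simp [hη0, hv])
    (fun s hs => by
      rw [norm_mul, mul_comm]
      exact mul_le_mul_of_nonneg_right (hK s ⟨hs.1, hs.2.le⟩) (norm_nonneg _)) 1 (by simp)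
  simpa using h

end Frobenius

/-! ### The integral equation for paths in a leaf. -/

section Frobenius

universe u

variable {𝕜 : Type u} [RCLike 𝕜] {E : Type u} [NormedAddCommGroup E] [NormedSpace 𝕜 E]

/-- The primitive vanishing at `0` of a continuous function on the unit interval. -/
def primitive : C(unitInterval, 𝕜) →L[𝕜] C(unitInterval, 𝕜) :=
  have hi (g : C(unitInterval, 𝕜)) (a b : ℝ) : IntervalIntegrable
      (Set.IccExtend zero_le_one g) MeasureTheory.volume a b :=
    (g.continuous.Icc_extend').intervalIntegrable a b
  LinearMap.mkContinuous
    { toFun := fun g => ⟨fun s => ∫ r in (0 : ℝ)..s, Set.IccExtend zero_le_one g r,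
        (intervalIntegral.continuous_primitive (hi g) 0).comp continuous_subtype_val⟩
      map_add' := fun g h => by
        ext s
        exact intervalIntegral.integral_add (hi g 0 s) (hi h 0 s)
      map_smul' := fun c g => by
        ext s
        exact intervalIntegral.integral_smul c (Set.IccExtend zero_le_one g) } 1
    (fun g => by
      rw [one_mul, ContinuousMap.norm_le _ (norm_nonneg _)]
      intro s
      refine (intervalIntegral.norm_integral_le_of_norm_le_const (C := ‖g‖)
        fun r _ => g.norm_coe_le_norm _).trans ?_
      rw [sub_zero, abs_of_nonneg s.2.1]
      exact mul_le_of_le_one_right (norm_nonneg _) s.2.2)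

theorem primitive_apply (g : C(unitInterval, 𝕜)) (s : unitInterval) :
    primitive g s = ∫ r in (0 : ℝ)..s, Set.IccExtend zero_le_one g r := rfl

theorem hasDerivAt_primitive (g : C(unitInterval, 𝕜)) (s : ℝ) :
    HasDerivAt (fun s : ℝ => ∫ r in (0 : ℝ)..s, Set.IccExtend zero_le_one g r)
      (Set.IccExtend zero_le_one g s) s := by
  have hc : Continuous (Set.IccExtend zero_le_one g) := g.continuous.Icc_extend'
  exact intervalIntegral.integral_hasDerivAt_right (hc.intervalIntegrable _ _)
    (hc.stronglyMeasurableAtFilter _ _) hc.continuousAt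

/-- The linear part of `leafPath`. -/
def leafPathLinear (e : E) :
    ((𝕜 × E) × C(unitInterval, 𝕜)) →L[𝕜] C(unitInterval, (𝕜 × E) × E) where
  toFun z := ⟨fun s => ((z.1.1, ((1 - s : ℝ) : 𝕜) • z.1.2 + z.2 s • e), z.1.2), by fun_prop⟩
  map_add' z z' := by ext s <;> (simp; try module)
  map_smul' c z := by ext s <;> (simp; try module)
  cont := by
    refine ContinuousMap.continuous_of_continuous_uncurry _ ?_
    simp only [Function.uncurry_def, ContinuousMap.coe_mk]
    fun_prop

/-- For a parameter `t`, a vector `ξ` and a function `y`, the path `p + (1 - s) ξ + y(s) e`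
together with the constants `t` and `ξ`. -/
def leafPath (p e : E) (z : (𝕜 × E) × C(unitInterval, 𝕜)) : C(unitInterval, (𝕜 × E) × E) :=
  ContinuousMap.const _ ((0, p), 0) + leafPathLinear e z

theorem leafPath_apply (p e : E) (z : (𝕜 × E) × C(unitInterval, 𝕜)) (s : unitInterval) :
    leafPath p e z s = ((z.1.1, p + ((1 - s : ℝ) : 𝕜) • z.1.2 + z.2 s • e), z.1.2) := by
  simp [leafPath, leafPathLinear, add_assoc]

theorem hasFDerivAt_leafPath (p e : E) (z : (𝕜 × E) × C(unitInterval, 𝕜)) :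
    HasFDerivAt (leafPath p e) (leafPathLinear (𝕜 := 𝕜) e) z :=
  (leafPathLinear (𝕜 := 𝕜) e).hasFDerivAt.const_add _

theorem contDiff_leafPath (p e : E) : ContDiff 𝕜 ∞ (leafPath (𝕜 := 𝕜) p e) :=
  contDiff_const.add (leafPathLinear (𝕜 := 𝕜) e).contDiff

/-- The form `θ` with parameter, applied to a vector. -/
def evalForm (θ : 𝕜 × E → E →L[𝕜] 𝕜) (z : (𝕜 × E) × E) : 𝕜 := θ z.1 z.2

theorem contDiffOn_evalForm {Ω : Set (𝕜 × E)} {θ : 𝕜 × E → E →L[𝕜] 𝕜} (hθ : ContDiffOn 𝕜 ∞ θ Ω) :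
    ContDiffOn 𝕜 ∞ (evalForm θ) (Prod.fst ⁻¹' Ω) :=
  (hθ.comp contDiffOn_fst fun _ h => h).clm_apply contDiffOn_snd

theorem fderiv_evalForm {θ : 𝕜 × E → E →L[𝕜] 𝕜} {z : (𝕜 × E) × E}
    (hθ : DifferentiableAt 𝕜 θ z.1) (w : (𝕜 × E) × E) :
    fderiv 𝕜 (evalForm θ) z w = fderiv 𝕜 θ z.1 w.1 z.2 + θ z.1 w.2 := by
  have h1 : HasFDerivAt (fun z : (𝕜 × E) × E => θ z.1) _ z :=
    hθ.hasFDerivAt.comp z hasFDerivAt_fst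
  have h := (h1.clm_apply (hasFDerivAt_snd (𝕜 := 𝕜) (p := z))).fderiv
  change fderiv 𝕜 (fun z : (𝕜 × E) × E => θ z.1 z.2) z w = _
  rw [h]
  simp [add_comm]

/-- The defect of `y` in the integral equation of a curve tangent to `θ = 0`. -/
def leafDefect (θ : 𝕜 × E → E →L[𝕜] 𝕜) (p e : E) (z : (𝕜 × E) × C(unitInterval, 𝕜)) :
    C(unitInterval, 𝕜) :=
  z.2 - primitive (superpose (evalForm θ) (leafPath p e z))

theorem hasFDerivAt_leafDefect {Ω : Set (𝕜 × E)} (hΩ : IsOpen Ω) {θ : 𝕜 × E → E →L[𝕜] 𝕜}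
    (hθ : ContDiffOn 𝕜 ∞ θ Ω) {p e : E} {z : (𝕜 × E) × C(unitInterval, 𝕜)}
    (hz : ∀ s, (leafPath p e z s).1 ∈ Ω) :
    HasFDerivAt (leafDefect θ p e) (ContinuousLinearMap.snd 𝕜 _ _ -
      primitive.comp ((pointwiseApply (superpose (fderiv 𝕜 (evalForm θ)) (leafPath p e z))).comp
        (leafPathLinear e))) z := by
  have hΩ' : IsOpen (Prod.fst ⁻¹' Ω : Set ((𝕜 × E) × E)) := hΩ.preimage continuous_fst
  have h1 := hasFDerivAt_superpose hΩ' ((contDiffOn_evalForm hθ).of_le (by simp)) hz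
  exact hasFDerivAt_snd.sub
    ((primitive (𝕜 := 𝕜)).hasFDerivAt.comp z (h1.comp z (hasFDerivAt_leafPath p e z)))

theorem contDiffAt_leafDefect {Ω : Set (𝕜 × E)} (hΩ : IsOpen Ω) {θ : 𝕜 × E → E →L[𝕜] 𝕜}
    (hθ : ContDiffOn 𝕜 ∞ θ Ω) {p e : E} {z : (𝕜 × E) × C(unitInterval, 𝕜)}
    (hz : ∀ s, (leafPath p e z s).1 ∈ Ω) : ContDiffAt 𝕜 ∞ (leafDefect θ p e) z := by
  have hΩ' : IsOpen (Prod.fst ⁻¹' Ω : Set ((𝕜 × E) × E)) := hΩ.preimage continuous_fst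
  have h1 := (contDiffOn_superpose (I := unitInterval) hΩ' (contDiffOn_evalForm hθ)).contDiffAt
    ((isOpen_setOf_forall_mem hΩ').mem_nhds hz)
  exact contDiffAt_snd.sub ((primitive (𝕜 := 𝕜)).contDiff.contDiffAt.comp z
    (h1.comp z (contDiff_leafPath p e).contDiffAt))

end Frobenius

/-! ### First integrals of a normalised form from leaf paths. -/

section Frobenius

universe u

variable {𝕜 : Type u} [RCLike 𝕜] {E : Type u} [NormedAddCommGroup E] [NormedSpace 𝕜 E]

/-- The set of all data whose path stays in `Ω`. -/
theorem isOpen_leafPath_mem {Ω : Set (𝕜 × E)} (hΩ : IsOpen Ω) (p e : E) :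
    IsOpen {z : (𝕜 × E) × C(unitInterval, 𝕜) | ∀ s, (leafPath p e z s).1 ∈ Ω} :=
  (isOpen_setOf_forall_mem (U := Prod.fst ⁻¹' Ω) (hΩ.preimage continuous_fst)).preimage
    (contDiff_leafPath (𝕜 := 𝕜) p e).continuous

theorem leafDefect_eq_zero_iff {Ω : Set (𝕜 × E)} (hΩ : IsOpen Ω) {θ : 𝕜 × E → E →L[𝕜] 𝕜}
    (hθ : ContDiffOn 𝕜 ∞ θ Ω) {p e : E} {z : (𝕜 × E) × C(unitInterval, 𝕜)}
    (hz : ∀ s, (leafPath p e z s).1 ∈ Ω) :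
    leafDefect θ p e z = 0 ↔ ∃ G : C(unitInterval, 𝕜), z.2 = primitive G ∧
      ∀ s, G s = θ (leafPath p e z s).1 z.1.2 := by
  have hΩ' : IsOpen (Prod.fst ⁻¹' Ω : Set ((𝕜 × E) × E)) := hΩ.preimage continuous_fst
  have key (s) : superpose (evalForm θ) (leafPath p e z) s = θ (leafPath p e z s).1 z.1.2 := by
    rw [superpose_apply hΩ' (contDiffOn_evalForm hθ).continuousOn hz, evalForm]
    simp [leafPath_apply]
  rw [leafDefect, sub_eq_zero]
  refine ⟨fun h => ⟨_, h, key⟩, fun ⟨G, h, hG⟩ => h.trans ?_⟩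
  congr 1
  ext s
  rw [hG, key]

/-- The variation of a family of solutions satisfies the linearised integral equation. -/
theorem fderiv_leaf_eq_primitive {Ω : Set (𝕜 × E)} (hΩ : IsOpen Ω) {θ : 𝕜 × E → E →L[𝕜] 𝕜}
    (hθ : ContDiffOn 𝕜 ∞ θ Ω) {p e : E} {g : 𝕜 × E → C(unitInterval, 𝕜)} {r : 𝕜 × E}
    (hz : ∀ s, (leafPath p e (r, g r) s).1 ∈ Ω) (hg : DifferentiableAt 𝕜 g r)
    (h0 : ∀ᶠ r' in 𝓝 r, leafDefect θ p e (r', g r') = 0) (v : E) :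
    ∃ G : C(unitInterval, 𝕜), fderiv 𝕜 g r (0, v) = primitive G ∧
      ∀ s, G s = fderiv 𝕜 θ (leafPath p e (r, g r) s).1
        (0, ((1 - s : ℝ) : 𝕜) • v + fderiv 𝕜 g r (0, v) s • e) r.2 +
          θ (leafPath p e (r, g r) s).1 v := by
  have hΩ' : IsOpen (Prod.fst ⁻¹' Ω : Set ((𝕜 × E) × E)) := hΩ.preimage continuous_fst
  refine ⟨pointwiseApply (superpose (fderiv 𝕜 (evalForm θ)) (leafPath p e (r, g r)))
    (leafPathLinear e ((0, v), fderiv 𝕜 g r (0, v))), ?_, fun s => ?_⟩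
  · have h1 := (hasFDerivAt_leafDefect hΩ hθ hz).comp r
      ((hasFDerivAt_id (𝕜 := 𝕜) r).prodMk hg.hasFDerivAt)
    have h2 : leafDefect θ p e ∘ (fun r' => (id r', g r')) =ᶠ[𝓝 r] fun _ => 0 := h0
    have h3 := DFunLike.congr_fun
      (h1.unique ((hasFDerivAt_const _ r).congr_of_eventuallyEq h2)) ((0, v) : 𝕜 × E)
    exact sub_eq_zero.1 h3
  · rw [pointwiseApply_apply, superpose_apply hΩ'
      ((contDiffOn_evalForm hθ).continuousOn_fderiv_of_isOpen hΩ' (by simp)) hz, fderiv_evalForm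
      ((hθ.differentiableOn (by simp)).differentiableAt (hΩ.mem_nhds (hz s)))]
    simp [leafPath_apply, leafPathLinear]

variable [CompleteSpace E]

/-- From $x=p+\xi$ one follows the leaf above the segment from $x$ to $p$, correcting in the
direction $e$; the path ends at $p+y(1)e$, and $F(t,x)=y(1)$. Smoothness in $(t,x)$ comes from
solving `leafDefect θ p e = 0` for `y` by implicit functions, constancy on leaves from
`eq_zero_of_leaf_variation`. -/
theorem exists_firstIntegral_normalized {Ω : Set (𝕜 × E)} (hΩ : IsOpen Ω)
    {θ : 𝕜 × E → E →L[𝕜] 𝕜} (hθ : ContDiffOn 𝕜 ∞ θ Ω) {e : E} (he : ∀ q ∈ Ω, θ q e = 1)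
    (hint : ∀ q ∈ Ω, ∀ u v, θ q u = 0 → θ q v = 0 →
      fderiv 𝕜 θ q (0, u) v = fderiv 𝕜 θ q (0, v) u)
    {t : 𝕜} {p : E} (hp : (t, p) ∈ Ω) :
    ∃ F : 𝕜 × E → 𝕜, (∀ᶠ q in 𝓝 (t, p), ContDiffAt 𝕜 ∞ F q) ∧
      (∀ᶠ q in 𝓝 (t, p), ∀ v, θ q v = 0 → fderiv 𝕜 F q (0, v) = 0) ∧
      fderiv 𝕜 F (t, p) (0, e) = 1 ∧ ∀ᶠ t' in 𝓝 t, F (t', p) = 0 := by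
  have hpath : ∀ t' s, leafPath p e ((t', (0 : E)), (0 : C(unitInterval, 𝕜))) s = ((t', p), 0) :=
    fun t' s => by simp [leafPath_apply]
  have hdef0 : ∀ t', (t', p) ∈ Ω → leafDefect θ p e ((t', 0), 0) = 0 := fun t' ht' =>
    (leafDefect_eq_zero_iff hΩ hθ fun s => by rwa [hpath]).2 ⟨0, by simp, by simp⟩
  have hO := isOpen_leafPath_mem hΩ p e
  have hz0 : ∀ s, (leafPath p e ((t, (0 : E)), (0 : C(unitInterval, 𝕜))) s).1 ∈ Ω := fun s => by
    rwa [hpath]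
  have hH : ∀ᶠ z in 𝓝 ((t, (0 : E)), (0 : C(unitInterval, 𝕜))),
      ContDiffAt 𝕜 ∞ (leafDefect θ p e) z := by
    filter_upwards [hO.mem_nhds hz0] with z hz using contDiffAt_leafDefect hΩ hθ hz
  -- For $\xi=0$ the integrand $\theta(\cdot)\xi$ does not react to `y`, so the defect has the
  -- identity as its partial derivative in `y`.
  obtain ⟨g, hg, hg0, hgeq⟩ := exists_implicit_of_smooth hH fun v => by
    rw [(hasFDerivAt_leafDefect hΩ hθ hz0).fderiv]
    have : pointwiseApply (superpose (fderiv 𝕜 (evalForm θ))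
        (leafPath p e ((t, (0 : E)), (0 : C(unitInterval, 𝕜))))) (leafPathLinear e (0, v)) = 0 := by
      ext s
      have hΩ' : IsOpen (Prod.fst ⁻¹' Ω : Set ((𝕜 × E) × E)) := hΩ.preimage continuous_fst
      rw [pointwiseApply_apply, superpose_apply hΩ'
        ((contDiffOn_evalForm hθ).continuousOn_fderiv_of_isOpen hΩ' (by simp)) hz0, fderiv_evalForm
        ((hθ.differentiableOn (by simp)).differentiableAt (hΩ.mem_nhds (hz0 s)))]
      simp [hpath, leafPathLinear]
    simp [this]
  rw [hdef0 t hp] at hgeq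
  have hgood : ∀ᶠ r in 𝓝 (t, (0 : E)), DifferentiableAt 𝕜 g r ∧
      (∀ s, (leafPath p e (r, g r) s).1 ∈ Ω) ∧ ∀ᶠ r' in 𝓝 r, leafDefect θ p e (r', g r') = 0 := by
    have hc : ContinuousAt (fun r => (r, g r)) (t, 0) :=
      continuousAt_id.prodMk hg.self_of_nhds.continuousAt
    have hmem := hc.preimage_mem_nhds (hO.mem_nhds (x := ((t, 0), g (t, 0))) (by rwa [hg0]))
    filter_upwards [hg, hmem, hgeq.eventually_nhds] with r h1 h2 h3
    exact ⟨h1.differentiableAt (by simp), h2, h3⟩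
  let S : 𝕜 × E → 𝕜 × E := fun q => (q.1, q.2 - p)
  have hSp : S (t, p) = (t, 0) := by simp [S]
  have hS : Filter.Tendsto S (𝓝 (t, p)) (𝓝 (t, 0)) := by
    rw [← hSp]
    exact Continuous.tendsto (by fun_prop) _
  have hS' (q) : HasFDerivAt S (ContinuousLinearMap.id 𝕜 (𝕜 × E)) q := by
    have hSeq : S = fun q => id q - (0, p) := by
      ext q <;> simp [S]
    rw [hSeq]
    exact (hasFDerivAt_id q).sub_const _
  have hF' : ∀ q, DifferentiableAt 𝕜 g (S q) → ∀ w,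
      fderiv 𝕜 (fun q => g (S q) 1) q w = fderiv 𝕜 g (S q) w 1 := fun q hq w => by
    have h := (ContinuousMap.evalCLM 𝕜 (1 : unitInterval)).hasFDerivAt.comp q
      (hq.hasFDerivAt.comp q (hS' q))
    exact DFunLike.congr_fun h.fderiv w
  refine ⟨fun q => g (S q) 1, ?_, ?_, ?_, ?_⟩
  · filter_upwards [hS.eventually hg] with q hq
    exact (ContinuousMap.evalCLM 𝕜 (1 : unitInterval)).contDiff.contDiffAt.comp q
      (hq.comp q (contDiffAt_fst.prodMk (contDiffAt_snd.sub contDiffAt_const)))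
  · filter_upwards [hS.eventually hgood] with q hq v hv
    obtain ⟨h1, h2, h3⟩ := hq
    rw [hF' q h1]
    obtain ⟨G, hG, hGs⟩ := (leafDefect_eq_zero_iff hΩ hθ h2).1 h3.self_of_nhds
    obtain ⟨G', hG', hGs'⟩ := fderiv_leaf_eq_primitive hΩ hθ h2 h1 h3 v
    set y : ℝ → 𝕜 := fun s => ∫ r in (0 : ℝ)..s, Set.IccExtend zero_le_one G r
    set η : ℝ → 𝕜 := fun s => ∫ r in (0 : ℝ)..s, Set.IccExtend zero_le_one G' r
    have hpath' (s : ℝ) (hs : s ∈ Set.Icc (0 : ℝ) 1) : (leafPath p e (S q, g (S q)) ⟨s, hs⟩).1 =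
        (q.1, p + ((1 - s : ℝ) : 𝕜) • (q.2 - p) + y s • e) := by
      rw [leafPath_apply]
      change (q.1, p + ((1 - s : ℝ) : 𝕜) • (q.2 - p) + g (S q) ⟨s, hs⟩ • e) = _
      rw [show g (S q) ⟨s, hs⟩ = y s from DFunLike.congr_fun hG _]
    have key := eq_zero_of_leaf_variation hΩ (hθ.of_le (by simp)) he hint (t := q.1) (y := y)
      (η := η) (p := p) (ξ := q.2 - p) (v := v) (fun s => rfl)
      (fun s hs => by rw [← hpath' s hs]; exact h2 _)
      (fun s hs => by
        rw [← hpath' s hs]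
        refine (hasDerivAt_primitive G s).congr_deriv ?_
        rw [Set.IccExtend_of_mem _ _ hs, hGs])
      (fun s hs => by
        rw [← hpath' s hs]
        refine (hasDerivAt_primitive G' s).congr_deriv ?_
        rw [Set.IccExtend_of_mem _ _ hs, hGs', hG', primitive_apply])
      (by simp [η]) (by simpa [y] using hv)
    rw [hG', primitive_apply]
    exact key
  · obtain ⟨h1, h2, h3⟩ := hgood.self_of_nhds
    rw [hF' _ (by rwa [hSp]), hSp]
    obtain ⟨G', hG', hGs'⟩ := fderiv_leaf_eq_primitive hΩ hθ h2 h1 h3 e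
    -- With $\xi=0$ and the variation $e$ only the term $\theta(e)=1$ remains in the linearised
    -- integrand.
    have hG1 : ∀ s, G' s = 1 := fun s => by
      rw [hGs', hg0, hpath]
      simp [he _ hp]
    rw [hG', primitive_apply]
    simp [Set.IccExtend, hG1]
  · have hc : ContinuousAt (fun t' : 𝕜 => (t', (0 : E))) t := by fun_prop
    filter_upwards [hc.eventually hgood] with t' ht'
    obtain ⟨G, hG, hGs⟩ := (leafDefect_eq_zero_iff hΩ hθ ht'.2.1).1 ht'.2.2.self_of_nhds
    have : G = 0 := by ext s; simp [hGs]
    have h2 : g (t', 0) = 0 := by simpa [this] using hG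
    simp [S, h2]

end Frobenius

/-! ### The Frobenius theorem for a general integrable family. -/

section Frobenius

/-- The integrability condition `a ∧ da = 0` at the point `x`. -/
def IsIntegrableFormAt {𝕜 E : Type*} [RCLike 𝕜] [NormedAddCommGroup E] [NormedSpace 𝕜 E]
    (a : E → E →L[𝕜] 𝕜) (x : E) : Prop :=
  ∀ u v w, a x u * (fderiv 𝕜 a x v w - fderiv 𝕜 a x w v) +
    a x v * (fderiv 𝕜 a x w u - fderiv 𝕜 a x u w) +
    a x w * (fderiv 𝕜 a x u v - fderiv 𝕜 a x v u) = 0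

theorem fderiv_partial_snd {𝕜 P E F : Type*} [NontriviallyNormedField 𝕜]
    [NormedAddCommGroup P] [NormedSpace 𝕜 P] [NormedAddCommGroup E] [NormedSpace 𝕜 E]
    [NormedAddCommGroup F] [NormedSpace 𝕜 F] {f : P × E → F} {q : P × E}
    (hf : DifferentiableAt 𝕜 f q) (v : E) :
    fderiv 𝕜 (fun x => f (q.1, x)) q.2 v = fderiv 𝕜 f q (0, v) := by
  have h : HasFDerivAt (fun x : E => (q.1, x)) (ContinuousLinearMap.inr 𝕜 P E) q.2 :=
    hasFDerivAt_prodMk_right q.1 q.2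
  have h2 := (hf.hasFDerivAt (x := (q.1, q.2))).comp q.2 h
  exact DFunLike.congr_fun h2.fderiv v

universe u

variable {𝕜 : Type u} [RCLike 𝕜] {E : Type u} [NormedAddCommGroup E] [NormedSpace 𝕜 E]
  [CompleteSpace E]

/-- **Frobenius theorem with a parameter**: an integrable family of one-forms has a first integral
that depends smoothly on the parameter. -/
theorem exists_firstIntegral {A : 𝕜 × E → E →L[𝕜] 𝕜} {t : 𝕜} {p : E}
    (hA : ∀ᶠ q in 𝓝 (t, p), ContDiffAt 𝕜 ∞ A q)
    (hint : ∀ᶠ q in 𝓝 (t, p), IsIntegrableFormAt (fun x => A (q.1, x)) q.2)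
    (h0 : A (t, p) ≠ 0) :
    ∃ F G : 𝕜 × E → 𝕜, (∀ᶠ q in 𝓝 (t, p), ContDiffAt 𝕜 ∞ F q) ∧
      (∀ᶠ q in 𝓝 (t, p), ContDiffAt 𝕜 ∞ G q) ∧ (∀ᶠ q in 𝓝 (t, p), G q ≠ 0) ∧
      (∀ᶠ q in 𝓝 (t, p), ∀ v, A q v = G q * fderiv 𝕜 F q (0, v)) ∧
      ∀ᶠ t' in 𝓝 t, F (t', p) = 0 := by
  obtain ⟨e, he⟩ : ∃ e, A (t, p) e ≠ 0 := by
    by_contra! h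
    exact h0 (ContinuousLinearMap.ext h)
  have hAe : ∀ᶠ q in 𝓝 (t, p), A q e ≠ 0 :=
    ((hA.self_of_nhds.clm_apply contDiffAt_const).continuousAt).eventually_ne he
  obtain ⟨Ω, hΩ, hΩo, hpΩ⟩ := eventually_nhds_iff.1 ((hA.and hint).and hAe)
  -- This scaling gives $\theta(e)=1$. On pairs of vectors in the kernel, $d\theta$ is a multiple of
  -- $dA$, and the latter vanishes by $A\wedge dA=0$ with third vector $e$.
  set θ : 𝕜 × E → E →L[𝕜] 𝕜 := fun q => (A q e)⁻¹ • A q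
  have hc : ∀ q ∈ Ω, ContDiffAt 𝕜 ∞ (fun q => (A q e)⁻¹) q := fun q hq =>
    ((hΩ q hq).1.1.clm_apply contDiffAt_const).inv (hΩ q hq).2
  have hθ : ContDiffOn 𝕜 ∞ θ Ω := fun q hq =>
    ((hc q hq).smul (hΩ q hq).1.1).contDiffWithinAt
  obtain ⟨F, hF, hker, hFe, hFp⟩ := exists_firstIntegral_normalized hΩo hθ (e := e)
    (fun q hq => by simp [θ, (hΩ q hq).2])
    (fun q hq u v hu hv => by
      have hd := (hΩ q hq).1.1.differentiableAt (by simp)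
      have hne := (hΩ q hq).2
      have hu' : A q u = 0 := by simpa [θ, hne] using hu
      have hv' : A q v = 0 := by simpa [θ, hne] using hv
      have h1 := ((hc q hq).differentiableAt (by simp)).hasFDerivAt.smul hd.hasFDerivAt
      have h2 := (hΩ q hq).1.2 u v e
      simp only [fderiv_partial_snd hd, hu', hv', zero_mul, zero_add, mul_eq_zero, hne,
        false_or, sub_eq_zero] at h2
      have h3 : fderiv 𝕜 θ q = _ := h1.fderiv
      rw [h3]
      simp [hu', hv', h2]) hpΩ
  have hFe' : ∀ᶠ q in 𝓝 (t, p), fderiv 𝕜 F q (0, e) ≠ 0 := by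
    have h1 := ((hF.self_of_nhds.fderiv_right (m := 0) (by simp)).clm_apply
      (contDiffAt_const (c := ((0 : 𝕜), e)))).continuousAt
    exact h1.eventually_ne (by rw [hFe]; exact one_ne_zero)
  -- The factor is forced by the value on $e$; any other vector differs by a multiple of $e$ from
  -- one in the common kernel.
  refine ⟨F, fun q => A q e / fderiv 𝕜 F q (0, e), hF, ?_, ?_, ?_, hFp⟩
  · filter_upwards [hA, hF, hFe'] with q h1 h2 h3
    exact (h1.clm_apply contDiffAt_const).div
      ((h2.fderiv_right (m := ∞) (by simp)).clm_apply contDiffAt_const) h3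
  · filter_upwards [hAe, hFe'] with q h1 h2 using div_ne_zero h1 h2
  · filter_upwards [hAe, hFe', hker] with q h1 h2 h3 v
    have h4 := h3 (v - (A q v / A q e) • e) (by simp [θ]; field_simp; simp)
    have h5 : ((0 : 𝕜), v - (A q v / A q e) • e) = (0, v) - (A q v / A q e) • (0, e) := by simp
    rw [h5, map_sub, map_smul, sub_eq_zero] at h4
    rw [h4, smul_eq_mul]
    field_simp

end Frobenius

/-! ### Eigenfunctions of a pencil of integrable one-forms -/

section Pencil

universe u

variable {𝕜 : Type u} [RCLike 𝕜] {E : Type u} [NormedAddCommGroup E] [NormedSpace 𝕜 E]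

/-- The pencil `α 0 + t α 1 + t² α 2` at the point `x`, for `q = (t, x)`. -/
def pencil (α : Fin 3 → E → E →L[𝕜] 𝕜) (q : 𝕜 × E) : E →L[𝕜] 𝕜 :=
  α 0 q.2 + q.1 • α 1 q.2 + q.1 ^ 2 • α 2 q.2

theorem pencil_apply (α : Fin 3 → E → E →L[𝕜] 𝕜) (q : 𝕜 × E) (v : E) :
    pencil α q v = α 0 q.2 v + q.1 * α 1 q.2 v + q.1 ^ 2 * α 2 q.2 v := rfl

theorem contDiffAt_pencil {α : Fin 3 → E → E →L[𝕜] 𝕜} {q : 𝕜 × E} {n : WithTop ℕ∞}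
    (hα : ∀ i, ContDiffAt 𝕜 n (α i) q.2) : ContDiffAt 𝕜 n (pencil α) q := by
  have h (i) : ContDiffAt 𝕜 n (fun q : 𝕜 × E => α i q.2) q := (hα i).comp q contDiffAt_snd
  exact ((h 0).add (contDiffAt_fst.smul (h 1))).add ((contDiffAt_fst.pow 2).smul (h 2))

/-- The derivative with respect to the parameter. -/
def dparam (f : 𝕜 × E → 𝕜) (q : 𝕜 × E) : 𝕜 := fderiv 𝕜 f q (1, 0)

theorem contDiffAt_dparam {f : 𝕜 × E → 𝕜} {q : 𝕜 × E} (hf : ContDiffAt 𝕜 ∞ f q) :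
    ContDiffAt 𝕜 ∞ (dparam f) q :=
  (hf.fderiv_right (m := ∞) (by simp)).clm_apply contDiffAt_const

theorem hasDerivAt_dparam {f : 𝕜 × E → 𝕜} {q : 𝕜 × E} (hf : DifferentiableAt 𝕜 f q) :
    HasDerivAt (fun t => f (t, q.2)) (dparam f q) q.1 :=
  (hf.hasFDerivAt (x := (q.1, q.2))).comp_hasDerivAt q.1
    ((hasDerivAt_id q.1).prodMk (hasDerivAt_const q.1 q.2))

theorem hasFDerivAt_comp_graph {f : 𝕜 × E → 𝕜} {l : E → 𝕜} {x : E}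
    (hf : DifferentiableAt 𝕜 f (l x, x)) (hl : DifferentiableAt 𝕜 l x) :
    HasFDerivAt (fun x => f (l x, x))
      (dparam f (l x, x) • fderiv 𝕜 l x +
        (fderiv 𝕜 f (l x, x)).comp (ContinuousLinearMap.inr 𝕜 𝕜 E)) x := by
  have h := HasFDerivAt.comp (f := fun x => (l x, x)) x hf.hasFDerivAt
    (hl.hasFDerivAt.prodMk (hasFDerivAt_id (𝕜 := 𝕜) x))
  refine h.congr_fderiv (ContinuousLinearMap.ext fun v => ?_)
  have : ((fderiv 𝕜 l x v, v) : 𝕜 × E) = fderiv 𝕜 l x v • (1, 0) + (0, v) := by simp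
  change fderiv 𝕜 f (l x, x) (fderiv 𝕜 l x v, v) = _
  rw [this, map_add, map_smul]
  simp [dparam, mul_comm]

theorem fderiv_comp_graph {f : 𝕜 × E → 𝕜} {l : E → 𝕜} {x : E}
    (hf : ContDiffAt 𝕜 ∞ f (l x, x)) (hl : ContDiffAt 𝕜 ∞ l x) (v : E) :
    fderiv 𝕜 (fun x => f (l x, x)) x v =
      dparam f (l x, x) * fderiv 𝕜 l x v + fderiv 𝕜 f (l x, x) (0, v) := by
  rw [(hasFDerivAt_comp_graph (hf.differentiableAt (by simp))
    (hl.differentiableAt (by simp))).fderiv]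
  simp

theorem dparam_fderiv_apply {f : 𝕜 × E → 𝕜} {q : 𝕜 × E} (hf : ContDiffAt 𝕜 ∞ f q) (v : E) :
    dparam (fun q => fderiv 𝕜 f q (0, v)) q = fderiv 𝕜 (dparam f) q (0, v) := by
  have hd : DifferentiableAt 𝕜 (fderiv 𝕜 f) q :=
    (hf.fderiv_right (m := ∞) (by simp)).differentiableAt (by simp)
  have hs : IsSymmSndFDerivAt 𝕜 f q := hf.isSymmSndFDerivAt (by
    simpa using (ENat.LEInfty.out : (2 : WithTop ℕ∞) ≤ ∞))
  have h1 (w w' : 𝕜 × E) :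
      fderiv 𝕜 (fun q => fderiv 𝕜 f q w) q w' = fderiv 𝕜 (fderiv 𝕜 f) q w' w := by
    rw [(hd.hasFDerivAt.clm_apply (hasFDerivAt_const w q)).fderiv]
    simp
  unfold dparam
  rw [h1, h1]
  exact hs _ _

/-- The identity `α^t = G d_x F` and its first two derivatives in `t`. -/
theorem pencil_jets {α : Fin 3 → E → E →L[𝕜] 𝕜} {F G : 𝕜 × E → 𝕜} {q₀ : 𝕜 × E}
    (hF : ∀ᶠ q in 𝓝 q₀, ContDiffAt 𝕜 ∞ F q) (hG : ∀ᶠ q in 𝓝 q₀, ContDiffAt 𝕜 ∞ G q)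
    (h : ∀ᶠ q in 𝓝 q₀, ∀ v, pencil α q v = G q * fderiv 𝕜 F q (0, v)) :
    (∀ᶠ q in 𝓝 q₀, ∀ v, α 1 q.2 v + 2 * q.1 * α 2 q.2 v =
      dparam G q * fderiv 𝕜 F q (0, v) + G q * fderiv 𝕜 (dparam F) q (0, v)) ∧
    ∀ᶠ q in 𝓝 q₀, ∀ v, 2 * α 2 q.2 v =
      dparam (dparam G) q * fderiv 𝕜 F q (0, v) +
        2 * dparam G q * fderiv 𝕜 (dparam F) q (0, v) +
          G q * fderiv 𝕜 (dparam (dparam F)) q (0, v) := by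
  have hder : ∀ {f g : 𝕜 × E → 𝕜} {q : 𝕜 × E} (v : E), ContDiffAt 𝕜 ∞ f q → ContDiffAt 𝕜 ∞ g q →
      HasDerivAt (fun t => f (t, q.2) * fderiv 𝕜 g (t, q.2) (0, v))
        (dparam f q * fderiv 𝕜 g q (0, v) + f q * fderiv 𝕜 (dparam g) q (0, v)) q.1 := by
    intro f g q v hf hg
    have h1 := hasDerivAt_dparam (hf.differentiableAt (by simp))
    have h2 := hasDerivAt_dparam (f := fun q => fderiv 𝕜 g q (0, v)) (q := q)
      (((hg.fderiv_right (m := ∞) (by simp)).clm_apply contDiffAt_const).differentiableAt (by simp))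
    rw [dparam_fderiv_apply hg] at h2
    exact h1.mul h2
  have hcont : ∀ q : 𝕜 × E, ContinuousAt (fun t : 𝕜 => (t, q.2)) q.1 := fun q => by fun_prop
  have first : ∀ᶠ q in 𝓝 q₀, ∀ v, α 1 q.2 v + 2 * q.1 * α 2 q.2 v =
      dparam G q * fderiv 𝕜 F q (0, v) + G q * fderiv 𝕜 (dparam F) q (0, v) := by
    filter_upwards [hF, hG, h.eventually_nhds] with q h1 h2 h3 v
    have h4 : HasDerivAt (fun t => pencil α (t, q.2) v) (α 1 q.2 v + 2 * q.1 * α 2 q.2 v) q.1 := by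
      simp only [pencil_apply]
      have := ((hasDerivAt_const q.1 (α 0 q.2 v)).add
        ((hasDerivAt_id q.1).mul_const (α 1 q.2 v))).add
          (((hasDerivAt_id q.1).pow 2).mul_const (α 2 q.2 v))
      exact this.congr_deriv (by simp)
    refine h4.unique ((hder v h2 h1).congr_of_eventuallyEq ?_)
    exact ((hcont q).eventually h3).mono fun t ht => ht v
  refine ⟨first, ?_⟩
  filter_upwards [hF, hG, first.eventually_nhds] with q h1 h2 h3 v
  have h4 : HasDerivAt (fun t => α 1 q.2 v + 2 * t * α 2 q.2 v) (2 * α 2 q.2 v) q.1 := by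
    have := (((hasDerivAt_id q.1).const_mul 2).mul_const (α 2 q.2 v)).const_add (α 1 q.2 v)
    exact this.congr_deriv (by simp)
  refine h4.unique ((((hder v (contDiffAt_dparam h2) h1).add
    (hder v h2 (contDiffAt_dparam h1))).congr_of_eventuallyEq ?_).congr_deriv (by ring))
  exact ((hcont q).eventually h3).mono fun t ht => ht v

theorem tendsto_graph {X Y : Type*} [TopologicalSpace X] [TopologicalSpace Y] {χ : X → Y} {t : Y} {p : X}
    (hχ : ContinuousAt χ p) (hp : χ p = t) :
    Filter.Tendsto (fun x => (χ x, x)) (𝓝 p) (𝓝 (t, p)) :=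
  hp ▸ hχ.prodMk continuousAt_id

variable [CompleteSpace E]

/-- A function `χ` with `F(χ(x), x) = χ(x) - t`. -/
theorem exists_eigenvalue_function {F : 𝕜 × E → 𝕜} {t : 𝕜} {p : E}
    (hF : ∀ᶠ q in 𝓝 (t, p), ContDiffAt 𝕜 ∞ F q) (hFp : ∀ᶠ t' in 𝓝 t, F (t', p) = 0) :
    ∃ χ : E → 𝕜, (∀ᶠ x in 𝓝 p, ContDiffAt 𝕜 ∞ χ x) ∧ χ p = t ∧ dparam F (t, p) = 0 ∧
      ∀ᶠ x in 𝓝 p, ∀ v, fderiv 𝕜 F (χ x, x) (0, v) =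
        (1 - dparam F (χ x, x)) * fderiv 𝕜 χ x v := by
  have hdF : dparam F (t, p) = 0 := by
    have h1 := hasDerivAt_dparam (hF.self_of_nhds.differentiableAt (by simp))
    have h2 : (fun t' => F (t', p)) =ᶠ[𝓝 t] fun _ => 0 := hFp
    exact h1.unique ((hasDerivAt_const t (0 : 𝕜)).congr_of_eventuallyEq h2)
  -- Since `F` vanishes at `p` for all nearby parameters, $F_t=0$ at the base point and $H$ has
  -- derivative $1$ in its last variable there. The solution satisfies $H(x,\chi(x))=H(p,t)=t$.
  let H : E × 𝕜 → 𝕜 := fun z => z.2 - F (z.2, z.1)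
  have hswap : Filter.Tendsto (fun z : E × 𝕜 => (z.2, z.1)) (𝓝 (p, t)) (𝓝 (t, p)) :=
    Continuous.tendsto (by fun_prop) _
  have hH : ∀ᶠ z in 𝓝 (p, t), ContDiffAt 𝕜 ∞ H z := by
    filter_upwards [hswap.eventually hF] with z hz
    exact contDiffAt_snd.sub (hz.comp z (contDiffAt_snd.prodMk contDiffAt_fst))
  have hH' : ∀ v, fderiv 𝕜 H (p, t) (0, v) = v := fun v => by
    have h1 : HasFDerivAt H _ (p, t) := hasFDerivAt_snd.sub
      (((hF.self_of_nhds.differentiableAt (by simp)).hasFDerivAt (x := (t, p))).comp (p, t)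
        (hasFDerivAt_snd.prodMk hasFDerivAt_fst))
    rw [h1.fderiv]
    change v - fderiv 𝕜 F (t, p) (v, 0) = v
    have h2 : ((v, 0) : 𝕜 × E) = v • (1, 0) := by simp
    rw [h2, map_smul]
    change v - v • dparam F (t, p) = v
    simp [hdF]
  obtain ⟨χ, hχ, hχp, hχe⟩ := exists_implicit_of_smooth hH hH'
  refine ⟨χ, hχ, hχp, hdF, ?_⟩
  have hF' := (tendsto_graph hχ.self_of_nhds.continuousAt hχp).eventually hF
  filter_upwards [hχ, hF', hχe.eventually_nhds] with x h1 h2 h3 v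
  have h4 := fderiv_comp_graph h2 h1 v
  have h5 : (fun x => F (χ x, x)) =ᶠ[𝓝 x] fun x => χ x - t := by
    filter_upwards [h3] with y hy
    simp only [H, hFp.self_of_nhds, sub_zero] at hy
    linear_combination -hy
  rw [h5.fderiv_eq, fderiv_sub_const] at h4
  linear_combination -h4

/-- The data of an eigenvalue `l` of a pencil, which is either constant or serves as a
coordinate. -/
def IsConstOrId (l : 𝕜 → 𝕜) (t : 𝕜) : Prop := (l = fun _ => t) ∨ l = fun s => s

/-- For a constant node $\chi$ is the first integral $F(t,\cdot)$. For a moving node it is the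
solution of $F(\chi(x),x)=\chi(x)-t$, for which $d_xF$ at $(\chi(x),x)$ is a multiple of $d\chi$. -/
theorem exists_eigenfunction {α : Fin 3 → E → E →L[𝕜] 𝕜} {t : 𝕜} {p : E}
    (hα : ∀ᶠ x in 𝓝 p, ∀ i, ContDiffAt 𝕜 ∞ (α i) x)
    (hint : ∀ᶠ q in 𝓝 (t, p), IsIntegrableFormAt (fun x => pencil α (q.1, x)) q.2)
    (h0 : pencil α (t, p) ≠ 0) {l : 𝕜 → 𝕜} (hl : IsConstOrId l t) :
    ∃ χ m : E → 𝕜, (∀ᶠ x in 𝓝 p, ContDiffAt 𝕜 ∞ χ x) ∧ l (χ p) = t ∧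
      ∀ᶠ x in 𝓝 p, ∀ v, pencil α (l (χ x), x) v = m x * fderiv 𝕜 χ x v := by
  have hA : ∀ᶠ q in 𝓝 (t, p), ContDiffAt 𝕜 ∞ (pencil α) q :=
    (continuousAt_snd.eventually hα).mono fun q hq => contDiffAt_pencil hq
  obtain ⟨F, G, hF, hG, -, hFG, hFp⟩ := exists_firstIntegral hA hint h0
  rcases hl with rfl | rfl
  · have hc : ContinuousAt (fun x : E => (t, x)) p := by fun_prop
    refine ⟨fun x => F (t, x), fun x => G (t, x), ?_, rfl, ?_⟩
    · filter_upwards [hc.eventually hF] with x hx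
      exact hx.comp x (contDiffAt_const.prodMk contDiffAt_id)
    · filter_upwards [hc.eventually hF, hc.eventually hFG] with x h1 h2 v
      rw [h2, fderiv_partial_snd (q := (t, x)) (h1.differentiableAt (by simp))]
  · obtain ⟨χ, hχ, hχp, -, hχF⟩ := exists_eigenvalue_function hF hFp
    have hFG' := (tendsto_graph hχ.self_of_nhds.continuousAt hχp).eventually hFG
    refine ⟨χ, fun x => G (χ x, x) * (1 - dparam F (χ x, x)), hχ, hχp, ?_⟩
    filter_upwards [hχF, hFG'] with x h1 h2 v
    rw [h2, h1, mul_assoc]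

end Pencil

/-! ### Coordinates at a multiple node of a real pencil. -/

section Pencil

variable {E : Type} [NormedAddCommGroup E] [NormedSpace ℝ E] [CompleteSpace E]

/-- For a real pencil, functions that express `α^l`, `d α^t / dt` at `t = l` and `α 2`
successively, in triangular form; `l` is the eigenvalue, which is constant or a coordinate. -/
theorem exists_eigenfunction_jets {α : Fin 3 → E → E →L[ℝ] ℝ} {t : ℝ} {p : E}
    (hα : ∀ᶠ x in 𝓝 p, ∀ i, ContDiffAt ℝ ∞ (α i) x)
    (hint : ∀ᶠ q in 𝓝 (t, p), IsIntegrableFormAt (fun x => pencil α (q.1, x)) q.2)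
    (h0 : pencil α (t, p) ≠ 0) {l : ℝ → ℝ} (hl : IsConstOrId l t) :
    ∃ χ ψ ρ m n k : E → ℝ, (∀ᶠ x in 𝓝 p, ContDiffAt ℝ ∞ χ x) ∧
      (∀ᶠ x in 𝓝 p, ContDiffAt ℝ ∞ ψ x) ∧ (∀ᶠ x in 𝓝 p, ContDiffAt ℝ ∞ ρ x) ∧ l (χ p) = t ∧
      ∀ᶠ x in 𝓝 p, ∀ v,
        pencil α (l (χ x), x) v = m x * fderiv ℝ χ x v ∧
        α 1 x v + 2 * l (χ x) * α 2 x v = m x * fderiv ℝ ψ x v + n x * fderiv ℝ χ x v ∧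
        α 2 x v = m x * Real.exp (-(deriv l (χ x) * ψ x)) * fderiv ℝ ρ x v +
          n x * fderiv ℝ ψ x v + k x * fderiv ℝ χ x v := by
  have hA : ∀ᶠ q in 𝓝 (t, p), ContDiffAt ℝ ∞ (pencil α) q :=
    (continuousAt_snd.eventually hα).mono fun q hq => contDiffAt_pencil hq
  obtain ⟨F, G, hF, hG, -, hFG, hFp⟩ := exists_firstIntegral hA hint h0
  obtain ⟨hFG1, hFG2⟩ := pencil_jets hF hG hFG
  have hF1 := hF.mono fun q hq => contDiffAt_dparam hq
  have hF2 := hF1.mono fun q hq => contDiffAt_dparam hq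
  rcases hl with rfl | rfl
  · have hc : ContinuousAt (fun x : E => (t, x)) p := by fun_prop
    have hsm {f : ℝ × E → ℝ} {x : E} (hf : ContDiffAt ℝ ∞ f (t, x)) :
        ContDiffAt ℝ ∞ (fun x => f (t, x)) x :=
      hf.comp x (contDiffAt_const.prodMk contDiffAt_id)
    have hfd {f : ℝ × E → ℝ} {x : E} (hf : ContDiffAt ℝ ∞ f (t, x)) (v : E) :
        fderiv ℝ (fun x => f (t, x)) x v = fderiv ℝ f (t, x) (0, v) :=
      fderiv_partial_snd (q := (t, x)) (hf.differentiableAt (by simp)) v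
    -- At a constant node the functions are the Taylor coefficients of $F$ and $G$ in the parameter.
    refine ⟨fun x => F (t, x), fun x => dparam F (t, x),
      fun x => 2⁻¹ * dparam (dparam F) (t, x), fun x => G (t, x), fun x => dparam G (t, x),
      fun x => 2⁻¹ * dparam (dparam G) (t, x), ?_, ?_, ?_, rfl, ?_⟩
    · filter_upwards [hc.eventually hF] with x hx using hsm hx
    · filter_upwards [hc.eventually hF1] with x hx using hsm hx
    · filter_upwards [hc.eventually hF2] with x hx using contDiffAt_const.mul (hsm hx)
    · filter_upwards [hc.eventually hF, hc.eventually hF1, hc.eventually hF2, hc.eventually hFG,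
        hc.eventually hFG1, hc.eventually hFG2] with x h1 h2 h3 h4 h5 h6 v
      rw [fderiv_const_mul ((hsm h3).differentiableAt (by simp)), smul_apply,
        hfd h1, hfd h2, hfd h3, h4]
      refine ⟨rfl, by linear_combination h5 v, ?_⟩
      simp only [deriv_const, zero_mul, neg_zero, Real.exp_zero, smul_eq_mul]
      linear_combination h6 v / 2
  · obtain ⟨χ, hχ, hχp, hdF, hχF⟩ := exists_eigenvalue_function hF hFp
    have hc := tendsto_graph hχ.self_of_nhds.continuousAt hχp
    set P : ℝ × E → ℝ := fun q => 1 - dparam F q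
    have hP : ∀ᶠ q in 𝓝 (t, p), ContDiffAt ℝ ∞ P q := hF1.mono fun q hq => contDiffAt_const.sub hq
    have hP0 : ∀ᶠ q in 𝓝 (t, p), 0 < P q :=
      hP.self_of_nhds.continuousAt.eventually (lt_mem_nhds (by simp [P, hdF]))
    have hsm {f : ℝ × E → ℝ} {x : E} (hf : ContDiffAt ℝ ∞ f (χ x, x)) (hχ : ContDiffAt ℝ ∞ χ x) :
        ContDiffAt ℝ ∞ (fun x => f (χ x, x)) x :=
      ContDiffAt.comp (f := fun x => (χ x, x)) x hf (hχ.prodMk contDiffAt_id)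
    -- Let $P=1-F_t$, so that $d_xF=P\,d\chi$ along $t=\chi(x)$. The choice $\psi=-\log P$ makes
    -- $d(F_t(\chi,x))=P\,d\psi$, whence $d_xF_t=P\,d\psi-F_{tt}\,d\chi$. Writing $F_{tt}=2P^2\rho$
    -- gives $d_xF_{tt}=2P^2d\rho-2F_{tt}\,d\psi-F_{ttt}\,d\chi$. Substituted into `pencil_jets`,
    -- this makes `m` and `n` recur as required, the exponential being $e^{-\psi}=P$.
    refine ⟨χ, fun x => -Real.log (P (χ x, x)),
      fun x => dparam (dparam F) (χ x, x) / (2 * P (χ x, x) ^ 2),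
      fun x => G (χ x, x) * P (χ x, x),
      fun x => dparam G (χ x, x) * P (χ x, x) - G (χ x, x) * dparam (dparam F) (χ x, x),
      fun x => 2⁻¹ * dparam (dparam G) (χ x, x) * P (χ x, x) -
        dparam G (χ x, x) * dparam (dparam F) (χ x, x) -
        2⁻¹ * G (χ x, x) * dparam (dparam (dparam F)) (χ x, x), hχ, ?_, ?_, hχp, ?_⟩
    · filter_upwards [hχ, hc.eventually hP, hc.eventually hP0] with x h1 h2 h3
      exact ((hsm h2 h1).log h3.ne').neg
    · filter_upwards [hχ, hc.eventually hP, hc.eventually hP0, hc.eventually hF2] with x h1 h2 h3 h4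
      exact (hsm h4 h1).div (contDiffAt_const.mul ((hsm h2 h1).pow 2))
        (mul_ne_zero two_ne_zero (pow_ne_zero _ h3.ne'))
    · filter_upwards [hχ, hc.eventually hF1, hc.eventually hF2, hc.eventually hP,
        (hc.eventually hP0).eventually_nhds, hc.eventually hFG, hc.eventually hFG1, hc.eventually hFG2, hχF]
        with x h1 h2 h3 h4 h5' h6 h7 h8 h9 v
      have h5 := h5'.self_of_nhds
      have e1 := h9 v
      have e2 := fderiv_comp_graph h2 h1 v
      have e3 := fderiv_comp_graph h3 h1 v
      have d2 := ((hsm h2 h1).differentiableAt (by simp)).hasFDerivAt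
      have d3 := ((hsm h3 h1).differentiableAt (by simp)).hasFDerivAt
      have dP : HasFDerivAt (fun x => P (χ x, x)) _ x := d2.const_sub 1
      have dψ := ((dP.log h5.ne').neg).fderiv
      have dρ := (((hsm h3 h1).div (contDiffAt_const.mul ((hsm h4 h1).pow 2))
        (mul_ne_zero (two_ne_zero' ℝ) (pow_ne_zero 2 h5.ne'))).differentiableAt
          (by simp)).hasFDerivAt.mul ((dP.pow 2).const_mul 2)
      have dρ' := dρ.unique (d3.congr_of_eventuallyEq (by
        filter_upwards [h5'] with y hy
        exact div_mul_cancel₀ _ (mul_ne_zero two_ne_zero (pow_ne_zero 2 hy.ne'))))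
      set p' := P (χ x, x)
      have e1' : fderiv ℝ F (χ x, x) (0, v) = p' * fderiv ℝ χ x v := e1
      have eψ : p' * fderiv ℝ (fun x => -Real.log (P (χ x, x))) x v =
          fderiv ℝ (fun x => dparam F (χ x, x)) x v := by
        have h : fderiv ℝ (fun x => -Real.log (P (χ x, x))) x v = _ := DFunLike.congr_fun dψ v
        rw [h]
        simp only [neg_apply, smul_apply, smul_eq_mul]
        field_simp
      have eρ : -2 * dparam (dparam F) (χ x, x) * fderiv ℝ (fun x => -Real.log (P (χ x, x))) x v +
          2 * p' ^ 2 * fderiv ℝ (fun x => dparam (dparam F) (χ x, x) / (2 * P (χ x, x) ^ 2)) x v =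
          fderiv ℝ (fun x => dparam (dparam F) (χ x, x)) x v := by
        have h := DFunLike.congr_fun dρ' v
        simp only [Pi.div_apply, neg_apply, smul_apply, add_apply, smul_eq_mul, ← eψ] at h
        rw [← h]
        change _ = dparam (dparam F) (χ x, x) / (2 * p' ^ 2) * _ + 2 * p' ^ 2 *
          fderiv ℝ (fun x => dparam (dparam F) (χ x, x) / (2 * P (χ x, x) ^ 2)) x v
        generalize fderiv ℝ (fun x => dparam (dparam F) (χ x, x) / (2 * P (χ x, x) ^ 2)) x v = R
        field_simp
        ring
      refine ⟨by rw [h6, e1']; ring, ?_, ?_⟩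
      · linear_combination h7 v + dparam G (χ x, x) * e1' - G (χ x, x) * e2 - G (χ x, x) * eψ
      · have hexp : Real.exp (-(deriv (fun s : ℝ => s) (χ x) * -Real.log p')) = p' := by
          simp [Real.exp_log h5]
        rw [hexp]
        linear_combination h8 v / 2 + dparam (dparam G) (χ x, x) / 2 * e1' -
          dparam G (χ x, x) * (e2 + eψ) - G (χ x, x) / 2 * (e3 + eρ)

end Pencil

/-! ### Integrability in coordinates and the four equations -/

section Gradient

/-- `u` is differentiable at `y` with partial derivatives `d`. -/
def HasGrad (u : E3 → ℝ) (y : E3) (d : Fin 3 → ℝ) : Prop :=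
  DifferentiableAt ℝ u y ∧ ∀ i, pd i u y = d i

variable {u v : E3 → ℝ} {y : E3} {d e : Fin 3 → ℝ}

theorem HasGrad.add (hu : HasGrad u y d) (hv : HasGrad v y e) :
    HasGrad (fun y => u y + v y) y (fun i => d i + e i) :=
  ⟨hu.1.add hv.1, fun i => by
    have h : fderiv ℝ (fun y => u y + v y) y = _ := (hu.1.hasFDerivAt.add hv.1.hasFDerivAt).fderiv
    change _ = d i + e i
    rw [← hu.2, ← hv.2, pd, h]; rfl⟩

theorem HasGrad.sub (hu : HasGrad u y d) (hv : HasGrad v y e) :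
    HasGrad (fun y => u y - v y) y (fun i => d i - e i) :=
  ⟨hu.1.sub hv.1, fun i => by
    have h : fderiv ℝ (fun y => u y - v y) y = _ := (hu.1.hasFDerivAt.sub hv.1.hasFDerivAt).fderiv
    change _ = d i - e i
    rw [← hu.2, ← hv.2, pd, h]; rfl⟩

theorem HasGrad.mul (hu : HasGrad u y d) (hv : HasGrad v y e) :
    HasGrad (fun y => u y * v y) y (fun i => d i * v y + u y * e i) :=
  ⟨hu.1.mul hv.1, fun i => by
    have h : fderiv ℝ (fun y => u y * v y) y = _ := (hu.1.hasFDerivAt.mul hv.1.hasFDerivAt).fderiv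
    change _ = d i * v y + u y * e i
    rw [← hu.2, ← hv.2, pd, h]
    simp [pd]
    ring⟩

theorem hasGrad_const (c : ℝ) (y : E3) : HasGrad (fun _ => c) y (fun _ => 0) :=
  ⟨differentiableAt_const c, fun i => by simp [pd]⟩

theorem HasGrad.comp {l : ℝ → ℝ} (hl : DifferentiableAt ℝ l (u y)) (hu : HasGrad u y d) :
    HasGrad (fun y => l (u y)) y (fun i => deriv l (u y) * d i) :=
  ⟨hl.comp y hu.1, fun i => by
    have h : fderiv ℝ (fun y => l (u y)) y = _ :=
      (hl.hasDerivAt.comp_hasFDerivAt y hu.1.hasFDerivAt).fderiv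
    change _ = deriv l (u y) * d i
    rw [← hu.2, pd, h]; rfl⟩

theorem hasGrad_coord (j : Fin 3) (y : E3) : HasGrad (fun y => y j) y (Pi.single j 1) := by
  have h : HasFDerivAt (fun y : E3 => y j) (EuclideanSpace.proj (𝕜 := ℝ) j) y :=
    (EuclideanSpace.proj (𝕜 := ℝ) j).hasFDerivAt
  refine ⟨h.differentiableAt, fun i => ?_⟩
  rw [pd, h.fderiv]
  simp [Pi.single_apply, eq_comm]

theorem contDiffAt_pd {f : E3 → ℝ} (hf : ContDiffAt ℝ ∞ f y) (i : Fin 3) :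
    ContDiffAt ℝ ∞ (pd i f) y :=
  (hf.fderiv_right (m := ∞) (by simp)).clm_apply contDiffAt_const

theorem hasGrad_pd {f : E3 → ℝ} (hf : ContDiffAt ℝ ∞ f y) (i : Fin 3) :
    HasGrad (pd i f) y (fun j => pd j (pd i f) y) :=
  ⟨(contDiffAt_pd hf i).differentiableAt (by simp), fun _ => rfl⟩

theorem pd_comm {f : E3 → ℝ} (hf : ContDiffAt ℝ ∞ f y) (i j : Fin 3) :
    pd i (pd j f) y = pd j (pd i f) y := by
  have hd : DifferentiableAt ℝ (fderiv ℝ f) y :=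
    (hf.fderiv_right (m := ∞) (by simp)).differentiableAt (by simp)
  have hs : IsSymmSndFDerivAt ℝ f y := hf.isSymmSndFDerivAt (by
    simpa using (ENat.LEInfty.out : (2 : WithTop ℕ∞) ≤ ∞))
  have h1 (w w' : E3) : fderiv ℝ (fun q => fderiv ℝ f q w) y w' = fderiv ℝ (fderiv ℝ f) y w' w :=
    fderiv_apply_apply hd w w'
  change fderiv ℝ (fun q => fderiv ℝ f q _) y _ = fderiv ℝ (fun q => fderiv ℝ f q _) y _
  rw [h1, h1]
  exact hs _ _

/-- The coefficient of `a ∧ da` for the one-form with components `a`. -/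
def curlDot (a : E3 → Fin 3 → ℝ) (y : E3) : ℝ :=
  a y 0 * (pd 1 (fun y => a y 2) y - pd 2 (fun y => a y 1) y) +
    a y 1 * (pd 2 (fun y => a y 0) y - pd 0 (fun y => a y 2) y) +
      a y 2 * (pd 0 (fun y => a y 1) y - pd 1 (fun y => a y 0) y)

theorem curlDot_eq {a : E3 → Fin 3 → ℝ} {d₀ d₁ d₂ : Fin 3 → ℝ}
    (h₀ : HasGrad (fun y => a y 0) y d₀) (h₁ : HasGrad (fun y => a y 1) y d₁)
    (h₂ : HasGrad (fun y => a y 2) y d₂) :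
    (∀ i, DifferentiableAt ℝ (fun y => a y i) y) ∧ curlDot a y =
      a y 0 * (d₂ 1 - d₁ 2) + a y 1 * (d₀ 2 - d₂ 0) + a y 2 * (d₁ 0 - d₀ 1) := by
  refine ⟨fun i => ?_, by simp only [curlDot, h₀.2, h₁.2, h₂.2]⟩
  fin_cases i
  exacts [h₀.1, h₁.1, h₂.1]

/-- Regularity of the functional parameters: they are smooth, and for type `D` the functions
`a + i b` are either constant or the coordinate `x₁ + i x₂`. -/
def Equation.IsRegular : Equation → Prop
  | .A l₁ l₂ l₃ => ContDiff ℝ ∞ l₁ ∧ ContDiff ℝ ∞ l₂ ∧ ContDiff ℝ ∞ l₃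
  | .B l₂ l₃ => ContDiff ℝ ∞ l₂ ∧ ContDiff ℝ ∞ l₃
  | .C l₃ => ContDiff ℝ ∞ l₃
  | .D a b l₃ => ContDiff ℝ ∞ l₃ ∧ ((∃ c₁ c₂, (a = fun _ _ => c₁) ∧ b = fun _ _ => c₂) ∨
      ((a = fun s _ => s) ∧ b = fun _ s => s))

theorem contDiff_of_isConstOrId {l : ℝ → ℝ} {t : ℝ} (hl : IsConstOrId l t) : ContDiff ℝ ∞ l := by
  rcases hl with rfl | rfl
  exacts [contDiff_const, contDiff_id]

variable {f : E3 → ℝ}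

theorem hasGrad_coord_comp {l : ℝ → ℝ} (hl : ContDiff ℝ ∞ l) (j : Fin 3) (y : E3) :
    HasGrad (fun y => l (y j)) y (fun i => deriv l (y j) * (Pi.single j 1 : Fin 3 → ℝ) i) :=
  HasGrad.comp (hl.differentiable (by simp) _) (hasGrad_coord j y)

/-- Each node contributes to $\alpha\wedge d\alpha$ a linear factor in $t$: at $t=l_i$ the form is a
multiple of $dx_i$ and the two other components vanish along the slice $x_i=\mathrm{const}$. What
remains is independent of $t$ and is the equation. In the other families multiple and complex nodes
enter with their multiplicities. -/
theorem equationA_curl {l₁ l₂ l₃ : ℝ → ℝ} (hQ : (Equation.A l₁ l₂ l₃).IsRegular)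
    (hf : ContDiffAt ℝ ∞ f y) (t : ℝ) :
    (∀ i, DifferentiableAt ℝ (fun y => (Equation.A l₁ l₂ l₃).form f t y i) y) ∧
      curlDot ((Equation.A l₁ l₂ l₃).form f t) y =
        (l₁ (y 0) - t) * (l₂ (y 1) - t) * (l₃ (y 2) - t) * (Equation.A l₁ l₂ l₃).lhs f y := by
  have g1 := (hasGrad_coord_comp hQ.1 0 y).sub (hasGrad_const t y)
  have g2 := (hasGrad_coord_comp hQ.2.1 1 y).sub (hasGrad_const t y)
  have g3 := (hasGrad_coord_comp hQ.2.2 2 y).sub (hasGrad_const t y)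
  have h0 := (g2.mul g3).mul (hasGrad_pd hf 0)
  have h1 := (g3.mul g1).mul (hasGrad_pd hf 1)
  have h2 := (g1.mul g2).mul (hasGrad_pd hf 2)
  have h := curlDot_eq (a := (Equation.A l₁ l₂ l₃).form f t) h0 h1 h2
  refine ⟨h.1, h.2.trans ?_⟩
  simp [Equation.form, Equation.lhs, pd_comm hf 0 1, pd_comm hf 0 2, pd_comm hf 1 2]
  ring

theorem equationB_curl {l₂ l₃ : ℝ → ℝ} (hQ : (Equation.B l₂ l₃).IsRegular)
    (hf : ContDiffAt ℝ ∞ f y) (t : ℝ) :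
    (∀ i, DifferentiableAt ℝ (fun y => (Equation.B l₂ l₃).form f t y i) y) ∧
      curlDot ((Equation.B l₂ l₃).form f t) y =
        (l₂ (y 1) - t) ^ 2 * (l₃ (y 2) - t) * (Equation.B l₂ l₃).lhs f y := by
  have g2 := (hasGrad_coord_comp hQ.1 1 y).sub (hasGrad_const t y)
  have g3 := (hasGrad_coord_comp hQ.2 2 y).sub (hasGrad_const t y)
  have h0 := (g2.mul g3).mul (hasGrad_pd hf 0)
  have h1 := ((g2.mul g3).mul (hasGrad_pd hf 1)).sub (g3.mul (hasGrad_pd hf 0))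
  have h2 := (g2.mul g2).mul (hasGrad_pd hf 2)
  simp only [← sq] at h2
  have h := curlDot_eq (a := (Equation.B l₂ l₃).form f t) h0 h1 h2
  refine ⟨h.1, h.2.trans ?_⟩
  simp [Equation.form, Equation.lhs, pd_comm hf 0 1, pd_comm hf 0 2, pd_comm hf 1 2]
  ring

theorem equationC_curl {l₃ : ℝ → ℝ} (hQ : (Equation.C l₃).IsRegular)
    (hf : ContDiffAt ℝ ∞ f y) (t : ℝ) :
    (∀ i, DifferentiableAt ℝ (fun y => (Equation.C l₃).form f t y i) y) ∧
      curlDot ((Equation.C l₃).form f t) y =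
        (l₃ (y 2) - t) ^ 3 * Real.exp (deriv l₃ (y 2) * y 1) * (Equation.C l₃).lhs f y := by
  have hQ' : ContDiff ℝ ∞ (deriv l₃) := (contDiff_infty_iff_deriv.1 hQ).2
  have g3 := (hasGrad_coord_comp hQ 2 y).sub (hasGrad_const t y)
  have gE := HasGrad.comp (Real.differentiable_exp _)
    ((hasGrad_coord_comp hQ' 2 y).mul (hasGrad_coord 1 y))
  have h0 := (g3.mul g3).mul (hasGrad_pd hf 0)
  have h1 := ((g3.mul g3).mul (hasGrad_pd hf 1)).sub ((g3.mul gE).mul (hasGrad_pd hf 0))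
  have h2 := (((g3.mul g3).mul (hasGrad_pd hf 2)).sub (g3.mul (hasGrad_pd hf 1))).add
    (gE.mul (hasGrad_pd hf 0))
  simp only [← sq] at h0 h1 h2
  have h := curlDot_eq (a := (Equation.C l₃).form f t) h0 h1 h2
  refine ⟨h.1, h.2.trans ?_⟩
  simp [Equation.form, Equation.lhs, pd_comm hf 0 1, pd_comm hf 0 2, pd_comm hf 1 2, Real.exp_neg]
  field_simp
  ring

theorem equationD_curl {a b : ℝ → ℝ → ℝ} {l₃ : ℝ → ℝ} (hQ : (Equation.D a b l₃).IsRegular)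
    (hf : ContDiffAt ℝ ∞ f y) (t : ℝ) :
    (∀ i, DifferentiableAt ℝ (fun y => (Equation.D a b l₃).form f t y i) y) ∧
      curlDot ((Equation.D a b l₃).form f t) y =
        ((a (y 0) (y 1) - t) ^ 2 + b (y 0) (y 1) ^ 2) * (l₃ (y 2) - t) *
          (Equation.D a b l₃).lhs f y := by
  have g3 := (hasGrad_coord_comp hQ.1 2 y).sub (hasGrad_const t y)
  -- The Cauchy–Riemann equations for $a+ib$ in $x_1+ix_2$ and independence of $x_3$ are all that
  -- the computation needs of `a` and `b`.
  obtain ⟨da, db, ga, gb, hab⟩ : ∃ da db : Fin 3 → ℝ, HasGrad (fun y => a (y 0) (y 1)) y da ∧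
      HasGrad (fun y => b (y 0) (y 1)) y db ∧
        da 0 = db 1 ∧ da 1 = -db 0 ∧ da 2 = 0 ∧ db 2 = 0 := by
    rcases hQ.2 with ⟨c₁, c₂, rfl, rfl⟩ | ⟨rfl, rfl⟩
    · exact ⟨_, _, hasGrad_const _ y, hasGrad_const _ y, by simp⟩
    · exact ⟨_, _, hasGrad_coord 0 y, hasGrad_coord 1 y, by simp⟩
  have gr := ga.sub (hasGrad_const t y)
  have h0 := g3.mul ((gr.mul (hasGrad_pd hf 0)).sub (gb.mul (hasGrad_pd hf 1)))
  have h1 := g3.mul ((gr.mul (hasGrad_pd hf 1)).add (gb.mul (hasGrad_pd hf 0)))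
  have h2 := ((gr.mul gr).add (gb.mul gb)).mul (hasGrad_pd hf 2)
  simp only [← sq] at h2
  have h := curlDot_eq (a := (Equation.D a b l₃).form f t) h0 h1 h2
  refine ⟨h.1, h.2.trans ?_⟩
  simp [Equation.form, Equation.lhs, pd_comm hf 0 1, pd_comm hf 0 2, pd_comm hf 1 2, hab]
  ring

/-- If all one-forms of the family are integrable at `y`, the equation holds at `y`. -/
theorem Equation.lhs_eq_zero_of_curlDot {Q : Equation} (hQ : Q.IsRegular)
    (hf : ContDiffAt ℝ ∞ f y) (h : ∀ t, curlDot (Q.form f t) y = 0) : Q.lhs f y = 0 := by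
  -- A parameter off the nodes makes the factor in front of the equation nonzero; superfluous slots
  -- are filled with `0` below.
  have key (c₁ c₂ c₃ : ℝ) : ∃ t, c₁ - t ≠ 0 ∧ c₂ - t ≠ 0 ∧ c₃ - t ≠ 0 := by
    refine ⟨|c₁| + |c₂| + |c₃| + 1, ?_, ?_, ?_⟩ <;> apply ne_of_lt <;>
      linarith [le_abs_self c₁, le_abs_self c₂, le_abs_self c₃, abs_nonneg c₁, abs_nonneg c₂,
        abs_nonneg c₃]
  match Q, hQ, h with
  | .A l₁ l₂ l₃, hQ, h =>
    obtain ⟨t, h1, h2, h3⟩ := key (l₁ (y 0)) (l₂ (y 1)) (l₃ (y 2))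
    have := (equationA_curl hQ hf t).2
    rw [h t] at this
    simpa [h1, h2, h3] using this
  | .B l₂ l₃, hQ, h =>
    obtain ⟨t, h1, h2, h3⟩ := key 0 (l₂ (y 1)) (l₃ (y 2))
    have := (equationB_curl hQ hf t).2
    rw [h t] at this
    simpa [h2, h3] using this
  | .C l₃, hQ, h =>
    obtain ⟨t, h1, h2, h3⟩ := key 0 0 (l₃ (y 2))
    have := (equationC_curl hQ hf t).2
    rw [h t] at this
    simpa [h3, Real.exp_ne_zero] using this
  | .D a b l₃, hQ, h =>
    obtain ⟨t, h1, h2, h3⟩ := key 0 (a (y 0) (y 1)) (l₃ (y 2))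
    have := (equationD_curl hQ hf t).2
    have h4 : (a (y 0) (y 1) - t) ^ 2 + b (y 0) (y 1) ^ 2 ≠ 0 := by positivity
    rw [h t] at this
    simpa [h4, h3] using this

theorem Equation.differentiableAt_form {Q : Equation} (hQ : Q.IsRegular)
    (hf : ContDiffAt ℝ ∞ f y) (t : ℝ) (i : Fin 3) :
    DifferentiableAt ℝ (fun y => Q.form f t y i) y :=
  match Q, hQ with
  | .A _ _ _, hQ => (equationA_curl hQ hf t).1 i
  | .B _ _, hQ => (equationB_curl hQ hf t).1 i
  | .C _, hQ => (equationC_curl hQ hf t).1 i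
  | .D _ _ _, hQ => (equationD_curl hQ hf t).1 i

end Gradient

/-! ### From coframes in a chart to nondegenerate solutions -/

section Functionals

variable {E : Type*} [NormedAddCommGroup E] [NormedSpace ℝ E]

theorem exists_smul_of_ker_eq {β γ : E →L[ℝ] ℝ} (h : ∀ v, γ v = 0 ↔ β v = 0) (hβ : β ≠ 0) :
    ∃ k : ℝ, k ≠ 0 ∧ γ = k • β := by
  obtain ⟨e, he⟩ : ∃ e, β e ≠ 0 := by
    by_contra! hc
    exact hβ (ContinuousLinearMap.ext hc)
  refine ⟨γ e / β e, div_ne_zero (fun hc => he ((h e).1 hc)) he, ContinuousLinearMap.ext fun v => ?_⟩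
  have h1 := (h (v - (β v / β e) • e)).2 (by simp [he])
  rw [map_sub, map_smul, sub_eq_zero] at h1
  rw [h1, smul_apply, smul_eq_mul, smul_eq_mul]
  ring

/-- A one-form that defines the tangent planes of the level sets of a function is integrable. -/
theorem isIntegrableFormAt_of_ker {a : E → E →L[ℝ] ℝ} {x : E} {h : E → ℝ}
    (ha : DifferentiableAt ℝ a x) (hh : ContDiffAt ℝ ∞ h x) (h0 : fderiv ℝ h x ≠ 0)
    (hker : ∀ᶠ y in 𝓝 x, ∀ v, fderiv ℝ h y v = 0 ↔ a y v = 0) : IsIntegrableFormAt a x := by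
  obtain ⟨e, he⟩ : ∃ e, fderiv ℝ h x e ≠ 0 := by
    by_contra! hc
    exact h0 (ContinuousLinearMap.ext hc)
  have hd : DifferentiableAt ℝ (fderiv ℝ h) x :=
    (hh.fderiv_right (m := ∞) (by simp)).differentiableAt (by simp)
  have hs : IsSymmSndFDerivAt ℝ h x := hh.isSymmSndFDerivAt (by
    simpa using (ENat.LEInfty.out : (2 : WithTop ℕ∞) ≤ ∞))
  have he' : ∀ᶠ y in 𝓝 x, fderiv ℝ h y e ≠ 0 :=
    (hd.continuousAt.clm_apply continuousAt_const).eventually_ne he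
  -- The proportionality of $a$ and $dh$ in product form can be differentiated at `x` directly.
  have hprod : ∀ᶠ y in 𝓝 x, ∀ v, a y v * fderiv ℝ h y e = a y e * fderiv ℝ h y v := by
    filter_upwards [hker, he'] with y h1 h2 v
    have h3 := (h1 (v - (fderiv ℝ h y v / fderiv ℝ h y e) • e)).1 (by simp [h2])
    rw [map_sub, map_smul, sub_eq_zero] at h3
    rw [h3, smul_eq_mul]
    field_simp
  have hev {b : E → E →L[ℝ] ℝ} (hb : DifferentiableAt ℝ b x) (v : E) :
      HasFDerivAt (fun y => b y v) (fderiv ℝ (fun y => b y v) x) x :=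
    (hb.clm_apply (differentiableAt_const v)).hasFDerivAt
  have hder (u v : E) : fderiv ℝ a x u v * fderiv ℝ h x e + a x v * fderiv ℝ (fderiv ℝ h) x u e =
      fderiv ℝ a x u e * fderiv ℝ h x v + a x e * fderiv ℝ (fderiv ℝ h) x u v := by
    have h1 := (((hev ha v).mul (hev hd e)).unique
      (((hev ha e).mul (hev hd v)).congr_of_eventuallyEq (hprod.mono fun y hy => hy v)))
    have h2 := DFunLike.congr_fun h1 u
    simp only [add_apply, smul_apply, smul_eq_mul, fderiv_apply_apply ha, fderiv_apply_apply hd]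
      at h2
    linear_combination h2
  have hx := hprod.self_of_nhds
  intro u v w
  -- Modulo the symmetric second derivative of $h$, the differentiated relation says that
  -- $h_e^2\,da=c\wedge dh$ at `x`, where $h_e=dh(e)$. As $a$ is a multiple of $dh$, the product
  -- $a\wedge da$ vanishes.
  set c : E → ℝ := fun u =>
    fderiv ℝ a x u e * fderiv ℝ h x e - a x e * fderiv ℝ (fderiv ℝ h) x u e
  have key (u v : E) : (fderiv ℝ a x u v - fderiv ℝ a x v u) * fderiv ℝ h x e ^ 2 =
      c u * fderiv ℝ h x v - c v * fderiv ℝ h x u := by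
    simp only [c]
    linear_combination fderiv ℝ h x e * (hder u v - hder v u) +
      fderiv ℝ h x e * a x e * hs.eq u v -
      fderiv ℝ (fderiv ℝ h) x u e * hx v + fderiv ℝ (fderiv ℝ h) x v e * hx u
  have h3 : fderiv ℝ h x e ^ 3 ≠ 0 := pow_ne_zero _ he
  refine (mul_eq_zero.1 ?_).resolve_right h3
  linear_combination (a x u * fderiv ℝ h x e) * key v w + (a x v * fderiv ℝ h x e) * key w u +
    (a x w * fderiv ℝ h x e) * key u v +
    (c v * fderiv ℝ h x w - c w * fderiv ℝ h x v) * hx u +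
    (c w * fderiv ℝ h x u - c u * fderiv ℝ h x w) * hx v +
    (c u * fderiv ℝ h x v - c v * fderiv ℝ h x u) * hx w

end Functionals

/-! ### One-forms on the model space by components. -/

section Components

/-- The linear form on `ℝ³` with the given components. -/
def formOfComponents (c : Fin 3 → ℝ) : E3 →L[ℝ] ℝ :=
  ∑ i, c i • (EuclideanSpace.proj i : E3 →L[ℝ] ℝ)

theorem formOfComponents_apply (c : Fin 3 → ℝ) (v : E3) :
    formOfComponents c v = ∑ i, c i * v i := by
  simp [formOfComponents]

theorem eq_formOfComponents (β : E3 →L[ℝ] ℝ) :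
    β = formOfComponents fun i => β (EuclideanSpace.single i 1) := by
  ext v
  rw [formOfComponents_apply]
  conv_lhs => rw [← (EuclideanSpace.basisFun (Fin 3) ℝ).sum_repr v]
  simp [mul_comm]

theorem differentiableAt_formOfComponents {a : E3 → Fin 3 → ℝ} {y : E3}
    (ha : ∀ i, DifferentiableAt ℝ (fun y => a y i) y) :
    DifferentiableAt ℝ (fun y => formOfComponents (a y)) y :=
  DifferentiableAt.fun_sum fun i _ => (ha i).smul_const _

theorem curlDot_eq_zero {a : E3 → Fin 3 → ℝ} {y : E3}
    (ha : ∀ i, DifferentiableAt ℝ (fun y => a y i) y)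
    (h : IsIntegrableFormAt (fun y => formOfComponents (a y)) y) : curlDot a y = 0 := by
  have hd := differentiableAt_formOfComponents ha
  have hc (y : E3) (i : Fin 3) : formOfComponents (a y) (EuclideanSpace.single i 1) = a y i := by
    simp [formOfComponents_apply]
  have h1 := h (EuclideanSpace.single 0 1) (EuclideanSpace.single 1 1) (EuclideanSpace.single 2 1)
  simp only [← fderiv_apply_apply hd, hc] at h1
  exact h1

end Components

/-! ### Foliations and first integrals read in a chart. -/

section Charts

variable {M : Type*} [TopologicalSpace M] [ChartedSpace E3 M]
  {ψ : OpenPartialHomeomorph M E3}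

theorem mfderiv_chart_surjective (hψ : ψ ∈ IsManifold.maximalAtlas (𝓡 3) ∞ M) {x : M}
    (hx : x ∈ ψ.source) : Function.Surjective (mfderiv (𝓡 3) (𝓡 3) ψ x) :=
  OpenPartialHomeomorph.MDifferentiable.mfderiv_surjective
    ⟨(contMDiffOn_of_mem_maximalAtlas hψ).mdifferentiableOn (by simp),
      (contMDiffOn_symm_of_mem_maximalAtlas hψ).mdifferentiableOn (by simp)⟩ hx

theorem contDiffAt_comp_chart_symm (hψ : ψ ∈ IsManifold.maximalAtlas (𝓡 3) ∞ M) {x : M}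
    (hx : x ∈ ψ.source) {f : M → ℝ} (hf : ContMDiffAt (𝓡 3) 𝓘(ℝ, ℝ) ∞ f x) :
    ContDiffAt ℝ ∞ (f ∘ ψ.symm) (ψ x) := by
  have h1 := contMDiffAt_symm_of_mem_maximalAtlas hψ (ψ.map_source hx)
  have h2 : ContMDiffAt (𝓡 3) 𝓘(ℝ, ℝ) ∞ f (ψ.symm (ψ x)) := by rwa [ψ.left_inv hx]
  exact (h2.comp (ψ x) h1).contDiffAt

theorem mfderiv_eq_fderiv_comp_chart (hψ : ψ ∈ IsManifold.maximalAtlas (𝓡 3) ∞ M) {x : M}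
    (hx : x ∈ ψ.source) {f : M → ℝ} (hf : ContMDiffAt (𝓡 3) 𝓘(ℝ, ℝ) ∞ f x)
    (v : TangentSpace (𝓡 3) x) :
    mfderiv (𝓡 3) 𝓘(ℝ, ℝ) f x v =
      fderiv ℝ (f ∘ ψ.symm) (ψ x) (mfderiv (𝓡 3) (𝓡 3) ψ x v) := by
  have h1 : f =ᶠ[𝓝 x] (f ∘ ψ.symm) ∘ ψ := by
    filter_upwards [ψ.open_source.mem_nhds hx] with y hy
    simp [ψ.left_inv hy]
  have h2 : MDifferentiableAt (𝓡 3) 𝓘(ℝ, ℝ) (f ∘ ψ.symm) (ψ x) :=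
    ((contDiffAt_comp_chart_symm hψ hx hf).differentiableAt (by simp)).mdifferentiableAt
  have h3 : MDifferentiableAt (𝓡 3) (𝓡 3) ψ x :=
    (contMDiffAt_of_mem_maximalAtlas hψ hx).mdifferentiableAt (by simp)
  exact (congrArg (fun L : E3 →L[ℝ] ℝ => L v) h1.mfderiv_eq).trans
    ((mfderiv_comp_apply x h2 h3 v).trans
      (congrArg (fun L : E3 →L[ℝ] ℝ => L (mfderiv (𝓡 3) (𝓡 3) ψ x v)) mfderiv_eq_fderiv))

/-- The tangent plane at a point in terms of a function and of a form in a chart. -/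
theorem fderiv_eq_zero_iff_of_ker_eq (hψ : ψ ∈ IsManifold.maximalAtlas (𝓡 3) ∞ M) {x : M}
    (hx : x ∈ ψ.source) {f : M → ℝ} (hf : ContMDiffAt (𝓡 3) 𝓘(ℝ, ℝ) ∞ f x) {β : E3 →L[ℝ] ℝ}
    {T : Submodule ℝ (TangentSpace (𝓡 3) x)} (hT : T = (mfderiv (𝓡 3) 𝓘(ℝ, ℝ) f x).ker)
    (hT' : T = (β.comp (mfderiv (𝓡 3) (𝓡 3) ψ x)).ker) (v : E3) :
    fderiv ℝ (f ∘ ψ.symm) (ψ x) v = 0 ↔ β v = 0 := by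
  obtain ⟨w, rfl⟩ := mfderiv_chart_surjective hψ hx v
  rw [← mfderiv_eq_fderiv_comp_chart hψ hx hf]
  have h1 : w ∈ T ↔ mfderiv (𝓡 3) 𝓘(ℝ, ℝ) f x w = 0 := by rw [hT]; exact LinearMap.mem_ker
  have h2 : w ∈ T ↔ β (mfderiv (𝓡 3) (𝓡 3) ψ x w) = 0 := by rw [hT']; exact LinearMap.mem_ker
  exact h1.symm.trans h2

theorem Foliation.isIntegrableFormAt (Φ : Foliation M)
    (hψ : ψ ∈ IsManifold.maximalAtlas (𝓡 3) ∞ M) {x : M} (hx : x ∈ ψ.source)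
    {a : E3 → E3 →L[ℝ] ℝ} (ha : DifferentiableAt ℝ a (ψ x))
    (hΦ : ∀ᶠ x' in 𝓝 x, Φ.tangent x' =
      ((a (ψ x')).comp (mfderiv (𝓡 3) (𝓡 3) ψ x')).ker) :
    IsIntegrableFormAt a (ψ x) := by
  obtain ⟨U, hU, hxU, h, hh, hU'⟩ := Φ.exists_submersion x
  have hat {x' : M} (hx' : x' ∈ U) : ContMDiffAt (𝓡 3) 𝓘(ℝ, ℝ) ∞ h x' :=
    hh.contMDiffAt (hU.mem_nhds hx')
  refine isIntegrableFormAt_of_ker ha (contDiffAt_comp_chart_symm hψ hx (hat hxU)) ?_ ?_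
  · intro h0
    refine (hU' x hxU).1 (ContinuousLinearMap.ext fun v => ?_)
    rw [mfderiv_eq_fderiv_comp_chart hψ hx (hat hxU), h0]
    rfl
  · rw [← ψ.map_nhds_eq hx, Filter.eventually_map]
    filter_upwards [hΦ, hU.mem_nhds hxU, ψ.open_source.mem_nhds hx] with x' h1 h2 h3
    exact fderiv_eq_zero_iff_of_ker_eq hψ h3 (hat h2) (hU' x' h2).2 h1

/-- The one-form of an equation, with a vector `g` in place of the gradient. -/
def Equation.formAt (Q : Equation) (y : E3) (g : Fin 3 → ℝ) (t : ℝ) : Fin 3 → ℝ :=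
  match Q with
  | .A l₁ l₂ l₃ =>
      ![(l₂ (y 1) - t) * (l₃ (y 2) - t) * g 0, (l₃ (y 2) - t) * (l₁ (y 0) - t) * g 1,
        (l₁ (y 0) - t) * (l₂ (y 1) - t) * g 2]
  | .B l₂ l₃ =>
      ![(l₂ (y 1) - t) * (l₃ (y 2) - t) * g 0,
        (l₂ (y 1) - t) * (l₃ (y 2) - t) * g 1 - (l₃ (y 2) - t) * g 0, (l₂ (y 1) - t) ^ 2 * g 2]
  | .C l₃ =>
      ![(l₃ (y 2) - t) ^ 2 * g 0,
        (l₃ (y 2) - t) ^ 2 * g 1 - (l₃ (y 2) - t) * Real.exp (deriv l₃ (y 2) * y 1) * g 0,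
        (l₃ (y 2) - t) ^ 2 * g 2 - (l₃ (y 2) - t) * g 1 + Real.exp (deriv l₃ (y 2) * y 1) * g 0]
  | .D a b l₃ =>
      ![(l₃ (y 2) - t) * ((a (y 0) (y 1) - t) * g 0 - b (y 0) (y 1) * g 1),
        (l₃ (y 2) - t) * ((a (y 0) (y 1) - t) * g 1 + b (y 0) (y 1) * g 0),
        ((a (y 0) (y 1) - t) ^ 2 + b (y 0) (y 1) ^ 2) * g 2]

theorem Equation.form_eq_formAt (Q : Equation) (f : E3 → ℝ) (t : ℝ) (y : E3) :
    Q.form f t y = Q.formAt y (fun i => pd i f y) t := by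
  cases Q <;> rfl

theorem Equation.formAt_smul (Q : Equation) (y : E3) (k : ℝ) (g : Fin 3 → ℝ) (t : ℝ) (i : Fin 3) :
    Q.formAt y (fun j => k * g j) t i = k * Q.formAt y g t i := by
  cases Q <;> fin_cases i <;> simp [Equation.formAt] <;> ring

/-- The pencil of linear forms `α 0 + t α 1 + t² α 2`. -/
def coPencil (α : Fin 3 → E3 →L[ℝ] ℝ) (t : ℝ) : E3 →L[ℝ] ℝ := α 0 + t • α 1 + t ^ 2 • α 2

/-- Since $df$ and $\alpha_2$ have the same kernel, $df=k\alpha_2$ with $k\ne0$; the form of the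
equation is linear in the gradient, so for `f` it equals $k\alpha^t$. Integrability gives the
equation, independence of the $\alpha_i$ gives nondegeneracy. -/
theorem isNondegenerateSolutionOn_of_chart (W : Web M) {Q : Equation} (hQ : Q.IsRegular)
    (hψ : ψ ∈ IsManifold.maximalAtlas (𝓡 3) ∞ M)
    (hα : ∀ x ∈ ψ.source, ∃ α : Fin 3 → E3 →L[ℝ] ℝ, LinearIndependent ℝ α ∧
      (∀ t : ℝ, (W.foliation (t : OnePoint ℝ)).tangent x =
        ((coPencil α t).comp (mfderiv (𝓡 3) (𝓡 3) ψ x)).ker) ∧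
      (W.foliation OnePoint.infty).tangent x = ((α 2).comp (mfderiv (𝓡 3) (𝓡 3) ψ x)).ker ∧
      ∀ t i, coPencil α t (EuclideanSpace.single i 1) =
        Q.formAt (ψ x) (fun j => α 2 (EuclideanSpace.single j 1)) t i)
    {V : Set M} (hV : IsOpen V) (hVψ : V ⊆ ψ.source) {f : M → ℝ}
    (hf : (W.foliation OnePoint.infty).IsFirstIntegralOn f V) :
    Q.IsNondegenerateSolutionOn (f ∘ ψ.symm) (ψ '' V) := by
  have hat {x : M} (hx : x ∈ V) : ContMDiffAt (𝓡 3) 𝓘(ℝ, ℝ) ∞ f x :=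
    hf.1.contMDiffAt (hV.mem_nhds hx)
  have hsm {x : M} (hx : x ∈ V) : ContDiffAt ℝ ∞ (f ∘ ψ.symm) (ψ x) :=
    contDiffAt_comp_chart_symm hψ (hVψ hx) (hat hx)
  have main : ∀ x ∈ V, ∃ (α : Fin 3 → E3 →L[ℝ] ℝ) (k : ℝ), LinearIndependent ℝ α ∧ k ≠ 0 ∧
      (∀ t : ℝ, (W.foliation (t : OnePoint ℝ)).tangent x =
        ((coPencil α t).comp (mfderiv (𝓡 3) (𝓡 3) ψ x)).ker) ∧
      ∀ t i, Q.form (f ∘ ψ.symm) t (ψ x) i = k * coPencil α t (EuclideanSpace.single i 1) := by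
    intro x hx
    obtain ⟨α, hli, ht, hinf, hform⟩ := hα x (hVψ hx)
    obtain ⟨k, hk, hfk⟩ := exists_smul_of_ker_eq
      (fderiv_eq_zero_iff_of_ker_eq hψ (hVψ hx) (hat hx) (hf.2 x hx) hinf) (hli.ne_zero 2)
    refine ⟨α, k, hli, hk, ht, fun t i => ?_⟩
    rw [hform, Q.form_eq_formAt, ← Q.formAt_smul]
    congr 2
    ext j
    rw [pd, hfk]
    rfl
  refine ⟨⟨?_, ?_⟩, ?_⟩
  · rintro _ ⟨x, hx, rfl⟩
    exact (hsm hx).contDiffWithinAt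
  · rintro _ ⟨x, hx, rfl⟩
    refine Equation.lhs_eq_zero_of_curlDot hQ (hsm hx) fun t => ?_
    have hd := Equation.differentiableAt_form hQ (hsm hx) t
    -- The factor `k` is chosen point by point with no regularity. This is harmless: integrability
    -- is deduced from the kernels and from differentiability of the form of `f` itself.
    refine curlDot_eq_zero hd ((W.foliation t).isIntegrableFormAt hψ (hVψ hx)
      (differentiableAt_formOfComponents hd) ?_)
    filter_upwards [hV.mem_nhds hx] with x' hx'
    obtain ⟨α, k, -, hk, ht, hform⟩ := main x' hx'
    have h1 : formOfComponents (Q.form (f ∘ ψ.symm) t (ψ x')) = k • coPencil α t := by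
      rw [eq_formOfComponents (k • coPencil α t)]
      congr 1
      ext i
      rw [hform]
      rfl
    rw [ht, h1]
    ext v
    change coPencil α t (mfderiv (𝓡 3) (𝓡 3) ψ x' v) = 0 ↔
      k * coPencil α t (mfderiv (𝓡 3) (𝓡 3) ψ x' v) = 0
    simp [hk]
  · rintro _ ⟨x, hx, rfl⟩
    obtain ⟨α, k, hli, hk, -, hform⟩ := main x hx
    let L : (E3 →L[ℝ] ℝ) →ₗ[ℝ] (Fin 3 → ℝ) :=
      { toFun := fun β i => k * β (EuclideanSpace.single i 1)
        map_add' := fun β γ => by ext i; simp [mul_add]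
        map_smul' := fun c β => by ext i; simp; ring }
    have hL : LinearMap.ker L = ⊥ := by
      refine LinearMap.ker_eq_bot'.2 fun β hβ => ?_
      have : (fun i => β (EuclideanSpace.single i 1)) = 0 := by
        ext i
        have := congrFun hβ i
        simpa [L, hk] using this
      exact (eq_formOfComponents β).trans (by rw [this]; simp [formOfComponents])
    refine ⟨fun i => L (α i), hli.map' L hL, fun t => ?_⟩
    ext i
    rw [hform]
    simp [L, coPencil]
    ring

end Charts

/-! ### New charts from a normal form of the pencil. -/

section Coordinates

theorem finrank_strongDual_E3 : Module.finrank ℝ (E3 →L[ℝ] ℝ) = 3 := by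
  rw [← (LinearMap.toContinuousLinearMap : (E3 →ₗ[ℝ] ℝ) ≃ₗ[ℝ] (E3 →L[ℝ] ℝ)).finrank_eq]
  exact (Subspace.dual_finrank_eq (K := ℝ) (V := E3)).trans (by simp)

theorem eq_zero_of_linearIndependent {α : Fin 3 → E3 →L[ℝ] ℝ} (hα : LinearIndependent ℝ α)
    {v : E3} (hv : ∀ i, α i v = 0) : v = 0 := by
  have hspan := hα.span_eq_top_of_card_eq_finrank (by simp [finrank_strongDual_E3])
  have h (β : E3 →L[ℝ] ℝ) : β v = 0 := by
    have hβ : β ∈ Submodule.span ℝ (Set.range α) := hspan ▸ Submodule.mem_top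
    induction hβ using Submodule.span_induction with
    | mem β hβ =>
      obtain ⟨i, rfl⟩ := hβ
      exact hv i
    | zero => rfl
    | add β γ _ _ h1 h2 => rw [add_apply, h1, h2, add_zero]
    | smul c β _ h => rw [smul_apply, h, smul_zero]
  ext i
  exact h (EuclideanSpace.proj i)

/-- The map to `ℝ³` with the given components. -/
def coordMap (χ : Fin 3 → E3 → ℝ) (x : E3) : E3 := WithLp.toLp 2 fun i => χ i x

theorem contDiffAt_coordMap {χ : Fin 3 → E3 → ℝ} {x : E3} (h : ∀ i, ContDiffAt ℝ ∞ (χ i) x) :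
    ContDiffAt ℝ ∞ (coordMap χ) x :=
  contDiffAt_euclidean.2 h

theorem fderiv_coordMap {χ : Fin 3 → E3 → ℝ} {x : E3} (h : ∀ i, ContDiffAt ℝ ∞ (χ i) x) (v : E3)
    (i : Fin 3) : fderiv ℝ (coordMap χ) x v i = fderiv ℝ (χ i) x v := by
  have h1 := (EuclideanSpace.proj (𝕜 := ℝ) i).hasFDerivAt.comp x
    ((contDiffAt_coordMap h).differentiableAt (by simp)).hasFDerivAt
  have h2 : fderiv ℝ (χ i) x = _ := h1.fderiv
  rw [h2]
  rfl

/-- The pencil `α` at `x` has the form that belongs to the equation `Q` in the coordinates `χ`. -/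
def HasNormalFormAt (Q : Equation) (α : Fin 3 → E3 → E3 →L[ℝ] ℝ) (χ : Fin 3 → E3 → ℝ) (x : E3) :
    Prop :=
  ∃ g : Fin 3 → ℝ, ∀ t v,
    pencil α (t, x) v = ∑ i, Q.formAt (coordMap χ x) g t i * fderiv ℝ (χ i) x v

/-- The form is quadratic in $t$ with leading coefficient $g$. This later identifies $g$ with the
components of $\alpha_2$. -/
theorem Equation.formAt_second_difference (Q : Equation) (y : E3) (g : Fin 3 → ℝ) (i : Fin 3) :
    Q.formAt y g 1 i + Q.formAt y g (-1) i - 2 * Q.formAt y g 0 i = 2 * g i := by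
  cases Q <;> fin_cases i <;> simp [Equation.formAt] <;> ring

variable {Q : Equation} {α : Fin 3 → E3 → E3 →L[ℝ] ℝ} {χ : Fin 3 → E3 → ℝ} {x : E3}

/-- A vector killed by all $d\chi_i$ is killed by the whole pencil, hence by three independent
forms. So the $\chi_i$ are local coordinates with no further check on each type. -/
theorem eq_zero_of_fderiv_eq_zero (h : HasNormalFormAt Q α χ x)
    (hα : LinearIndependent ℝ fun i => α i x) {v : E3} (hv : ∀ i, fderiv ℝ (χ i) x v = 0) :
    v = 0 := by
  obtain ⟨g, hg⟩ := h
  have h1 (t : ℝ) : α 0 x v + t * α 1 x v + t ^ 2 * α 2 x v = 0 := by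
    rw [← pencil_apply α (t, x), hg]
    simp [hv]
  refine eq_zero_of_linearIndependent hα fun i => ?_
  have := h1 0
  have := h1 1
  have := h1 (-1)
  fin_cases i <;> simp only [Fin.isValue, Fin.mk_one, Fin.zero_eta, Fin.reduceFinMk] <;> linarith

theorem exists_coords_equiv (h : HasNormalFormAt Q α χ x)
    (hα : LinearIndependent ℝ fun i => α i x) (hχ : ∀ i, ContDiffAt ℝ ∞ (χ i) x) :
    ∃ A : E3 ≃L[ℝ] E3, HasFDerivAt (coordMap χ) (A : E3 →L[ℝ] E3) x := by
  have hinj : Function.Injective (fderiv ℝ (coordMap χ) x : E3 →ₗ[ℝ] E3) := by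
    refine (injective_iff_map_eq_zero _).2 fun v hv => eq_zero_of_fderiv_eq_zero h hα fun i => ?_
    rw [← fderiv_coordMap hχ]
    exact congrArg (fun w : E3 => w i) hv
  refine ⟨(LinearEquiv.ofInjectiveEndo _ hinj).toContinuousLinearEquiv, ?_⟩
  refine ((contDiffAt_coordMap hχ).differentiableAt (by simp)).hasFDerivAt.congr_fderiv ?_
  ext v : 1
  rfl

variable {M : Type*} [TopologicalSpace M] [ChartedSpace E3 M] [IsManifold (𝓡 3) ∞ M]

theorem trans_mem_maximalAtlas {φ : OpenPartialHomeomorph M E3}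
    (hφ : φ ∈ IsManifold.maximalAtlas (𝓡 3) ∞ M) {e : OpenPartialHomeomorph E3 E3}
    (he : ∀ x ∈ e.source, ContDiffAt ℝ ∞ e x) (he' : ∀ y ∈ e.target, ContDiffAt ℝ ∞ e.symm y) :
    φ ≫ₕ e ∈ IsManifold.maximalAtlas (𝓡 3) ∞ M := by
  refine OpenPartialHomeomorph.mem_maximalAtlas_of_contMDiffOn _ (fun x hx => ?_) fun y hy => ?_
  · rw [OpenPartialHomeomorph.trans_source] at hx
    exact ((he _ hx.2).contMDiffAt.comp x
      (contMDiffAt_of_mem_maximalAtlas hφ hx.1)).contMDiffWithinAt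
  · rw [OpenPartialHomeomorph.trans_target] at hy
    exact ((contMDiffAt_symm_of_mem_maximalAtlas hφ hy.2).comp y
      (he' y hy.1).contMDiffAt).contMDiffWithinAt

/-- Coordinates in which the pencil of a web has the form that belongs to an equation. -/
theorem exists_chart_of_hasNormalForm (W : Web M) {Q : Equation} (hQ : Q.IsRegular) {p : M}
    {φ : OpenPartialHomeomorph M E3} (hφ : φ ∈ IsManifold.maximalAtlas (𝓡 3) ∞ M)
    (hp : p ∈ φ.source) {k : WithTop ℕ∞} {α : Fin 3 → E3 → E3 →L[ℝ] ℝ}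
    (hα : IsVeroneseCoframe k W.foliation φ α) {χ : Fin 3 → E3 → ℝ}
    (hχ : ∀ i, ∀ᶠ x in 𝓝 (φ p), ContDiffAt ℝ ∞ (χ i) x)
    (h : ∀ᶠ x in 𝓝 (φ p), HasNormalFormAt Q α χ x) :
    ∃ ψ ∈ IsManifold.maximalAtlas (𝓡 3) ∞ M, p ∈ ψ.source ∧
      ∀ V : Set M, IsOpen V → V ⊆ ψ.source →
        ∀ f : M → ℝ, (W.foliation OnePoint.infty).IsFirstIntegralOn f V →
          Q.IsNondegenerateSolutionOn (f ∘ ψ.symm) (ψ '' V) := by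
  have hχ' := Filter.eventually_all.2 hχ
  obtain ⟨A, hA⟩ := exists_coords_equiv h.self_of_nhds
    (hα.linearIndependent _ (φ.map_source hp)) hχ'.self_of_nhds
  obtain ⟨e, hpe, hes, hex, hesm, hesymm⟩ := exists_openPartialHomeomorph_of_smooth
    (hχ'.mono fun x hx => contDiffAt_coordMap hx) hA (hχ'.and h)
  have hecoe : (e : E3 → E3) = coordMap χ := funext hex
  have hψ : φ ≫ₕ e ∈ IsManifold.maximalAtlas (𝓡 3) ∞ M :=
    trans_mem_maximalAtlas hφ (fun x hx => hecoe ▸ hesm x hx) hesymm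
  refine ⟨φ ≫ₕ e, hψ, by simp [hp, hpe], fun V hV hVψ f hf =>
    isNondegenerateSolutionOn_of_chart W hQ hψ (fun x hx => ?_) hV hVψ hf⟩
  rw [OpenPartialHomeomorph.trans_source] at hx
  have hxφ : x ∈ φ.source := hx.1
  obtain ⟨hχx, hnf⟩ := hes hx.2
  have hli := hα.linearIndependent _ (φ.map_source hxφ)
  obtain ⟨A, hA⟩ := exists_coords_equiv hnf hli hχx
  have hAv (v : E3) (i : Fin 3) : A v i = fderiv ℝ (χ i) (φ x) v := by
    rw [← fderiv_coordMap hχx, hA.fderiv]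
    rfl
  obtain ⟨g, hg⟩ := hnf
  have hmf (w : TangentSpace (𝓡 3) x) : mfderiv (𝓡 3) (𝓡 3) (φ ≫ₕ e) x w =
      A (mfderiv (𝓡 3) (𝓡 3) φ x w) := by
    have h1 : MDifferentiableAt (𝓡 3) (𝓡 3) e (φ x) := by
      rw [hecoe]
      exact hA.differentiableAt.mdifferentiableAt
    have h2 : MDifferentiableAt (𝓡 3) (𝓡 3) φ x :=
      (contMDiffAt_of_mem_maximalAtlas hφ hxφ).mdifferentiableAt (by simp)
    have h3 : fderiv ℝ e (φ x) = (A : E3 →L[ℝ] E3) := by rw [hecoe, hA.fderiv]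
    exact (mfderiv_comp_apply x h1 h2 w).trans
      (congrArg (fun L : E3 →L[ℝ] E3 => L (mfderiv (𝓡 3) (𝓡 3) φ x w)) (mfderiv_eq_fderiv.trans h3))
  have hker (β : E3 →L[ℝ] ℝ) : (β.comp (mfderiv (𝓡 3) (𝓡 3) φ x)).ker =
      ((β.comp (A.symm : E3 →L[ℝ] E3)).comp (mfderiv (𝓡 3) (𝓡 3) (φ ≫ₕ e) x)).ker := by
    ext w
    change β (mfderiv (𝓡 3) (𝓡 3) φ x w) = 0 ↔
      β (A.symm (mfderiv (𝓡 3) (𝓡 3) (φ ≫ₕ e) x w)) = 0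
    rw [hmf]
    exact (A.symm_apply_apply _ ▸ Iff.rfl)
  have hco (t : ℝ) (i : Fin 3) :
      pencil α (t, φ x) (A.symm (EuclideanSpace.single i 1)) =
        Q.formAt (coordMap χ (φ x)) g t i := by
    rw [hg]
    simp [← hAv]
  refine ⟨fun i => (α i (φ x)).comp (A.symm : E3 →L[ℝ] E3), ?_, fun t => ?_, ?_, fun t i => ?_⟩
  · refine LinearIndependent.of_comp
      (ContinuousLinearMap.precomp ℝ (A : E3 →L[ℝ] E3)).toLinearMap ?_
    convert hli using 1
    ext i v : 2
    simp
  · rw [hα.tangent_coe x hxφ t]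
    exact hker (pencil α (t, φ x))
  · rw [hα.tangent_infty x hxφ]
    exact hker _
  -- Comparison of the coefficients of $t^2$ in the normal form.
  · have h2 : (fun j => ((α 2 (φ x)).comp (A.symm : E3 →L[ℝ] E3)) (EuclideanSpace.single j 1)) =
        g := by
      ext j
      have h3 := Q.formAt_second_difference (coordMap χ (φ x)) g j
      simp only [← hco, pencil_apply] at h3
      change α 2 (φ x) (A.symm (EuclideanSpace.single j 1)) = g j
      linarith
    rw [h2]
    have h4 : (φ ≫ₕ e) x = coordMap χ (φ x) := hex _
    rw [h4, ← hco]
    rfl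

end Coordinates

/-! ### Normal forms of types A, B and C -/

section NormalForms

/-- A smooth pencil of integrable one-forms near `p`, with linearly independent coefficients. -/
structure IsIntegrablePencilNear (α : Fin 3 → E3 → E3 →L[ℝ] ℝ) (p : E3) : Prop where
  contDiffAt : ∀ᶠ x in 𝓝 p, ∀ i, ContDiffAt ℝ ∞ (α i) x
  linearIndependent : LinearIndependent ℝ fun i => α i p
  integrable : ∀ᶠ x in 𝓝 p, ∀ t : ℝ, IsIntegrableFormAt (fun x => pencil α (t, x)) x

variable {M : Type*} [TopologicalSpace M] [ChartedSpace E3 M]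

theorem IsVeroneseCoframe.isIntegrablePencilNear {W : Web M} {p : M}
    {φ : OpenPartialHomeomorph M E3} (hφ : φ ∈ IsManifold.maximalAtlas (𝓡 3) ∞ M)
    (hp : p ∈ φ.source) {k : WithTop ℕ∞} (hk : ∞ ≤ k) {α : Fin 3 → E3 → E3 →L[ℝ] ℝ}
    (hα : IsVeroneseCoframe k W.foliation φ α) : IsIntegrablePencilNear α (φ p) := by
  have hsm {x : E3} (hx : x ∈ φ.target) (i : Fin 3) : ContDiffAt ℝ ∞ (α i) x :=
    ((hα.contDiffOn i).contDiffAt (φ.open_target.mem_nhds hx)).of_le hk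
  have htar := φ.open_target.mem_nhds (φ.map_source hp)
  refine ⟨?_, hα.linearIndependent _ (φ.map_source hp), ?_⟩
  · filter_upwards [htar] with x hx using hsm hx
  · filter_upwards [htar] with x hx t
    have hd : DifferentiableAt ℝ (fun x => pencil α (t, x)) x :=
      (ContDiffAt.comp x (contDiffAt_pencil (q := (t, x)) (hsm hx))
        (contDiffAt_const.prodMk contDiffAt_id)).differentiableAt (by simp)
    have hx' := φ.map_target hx
    rw [← φ.right_inv hx] at hd ⊢
    refine (W.foliation t).isIntegrableFormAt hφ hx' hd ?_
    filter_upwards [φ.open_source.mem_nhds hx'] with x' hx'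
    exact hα.tangent_coe x' hx' t

variable {α : Fin 3 → E3 → E3 →L[ℝ] ℝ} {p : E3}

theorem IsIntegrablePencilNear.integrable_prod (h : IsIntegrablePencilNear α p) (t : ℝ) :
    ∀ᶠ q in 𝓝 (t, p), IsIntegrableFormAt (fun x => pencil α (q.1, x)) q.2 :=
  (continuousAt_snd.eventually h.integrable).mono fun q hq => hq q.1

theorem pencil_ne_zero (h : LinearIndependent ℝ fun i => α i p) (t : ℝ) : pencil α (t, p) ≠ 0 := by
  intro h0
  have h1 := (Fintype.linearIndependent_iff.1 h) ![1, t, t ^ 2]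
    (by simpa [Fin.sum_univ_three, pencil] using h0) 0
  simp at h1

theorem IsIntegrablePencilNear.exists_eigenfunction (h : IsIntegrablePencilNear α p) {l : ℝ → ℝ}
    {t : ℝ} (hl : IsConstOrId l t) : ∃ χ m : E3 → ℝ, (∀ᶠ x in 𝓝 p, ContDiffAt ℝ ∞ χ x) ∧
      l (χ p) = t ∧ ∀ᶠ x in 𝓝 p, ∀ v, pencil α (l (χ x), x) v = m x * fderiv ℝ χ x v :=
  Veronese.exists_eigenfunction h.contDiffAt (h.integrable_prod t)
    (pencil_ne_zero h.linearIndependent t) hl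

theorem eventually_ne_of_isConstOrId {l l' : ℝ → ℝ} {t t' : ℝ} (hl : IsConstOrId l t)
    (hl' : IsConstOrId l' t') {χ χ' : E3 → ℝ} (hχ : ∀ᶠ x in 𝓝 p, ContDiffAt ℝ ∞ χ x)
    (hχ' : ∀ᶠ x in 𝓝 p, ContDiffAt ℝ ∞ χ' x) (ht : l (χ p) = t) (ht' : l' (χ' p) = t')
    (hne : t ≠ t') : ∀ᶠ x in 𝓝 p, l (χ x) - l' (χ' x) ≠ 0 := by
  have hc : ContinuousAt (fun x => l (χ x) - l' (χ' x)) p :=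
    ((contDiff_of_isConstOrId hl).continuous.continuousAt.comp
      hχ.self_of_nhds.continuousAt).sub ((contDiff_of_isConstOrId hl').continuous.continuousAt.comp
      hχ'.self_of_nhds.continuousAt)
  exact hc.eventually_ne (by rw [ht, ht']; exact sub_ne_zero.2 hne)

/-- Lagrange interpolation at the nodes $L_1,L_2,L_3$: at $t=L_i$ only the $i$-th component of the
form survives, and comparison with $m_i\,d\chi_i$ determines $g$. The nodes are distinct at `p`,
hence nearby. -/
theorem IsIntegrablePencilNear.hasNormalForm_A (h : IsIntegrablePencilNear α p)
    {l₁ l₂ l₃ : ℝ → ℝ} {t₁ t₂ t₃ : ℝ} (h₁ : IsConstOrId l₁ t₁) (h₂ : IsConstOrId l₂ t₂)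
    (h₃ : IsConstOrId l₃ t₃) (h₁₂ : t₁ ≠ t₂) (h₁₃ : t₁ ≠ t₃) (h₂₃ : t₂ ≠ t₃) :
    ∃ χ : Fin 3 → E3 → ℝ, (∀ i, ∀ᶠ x in 𝓝 p, ContDiffAt ℝ ∞ (χ i) x) ∧
      ∀ᶠ x in 𝓝 p, HasNormalFormAt (.A l₁ l₂ l₃) α χ x := by
  obtain ⟨χ₁, m₁, s₁, e₁, H₁⟩ := h.exists_eigenfunction h₁
  obtain ⟨χ₂, m₂, s₂, e₂, H₂⟩ := h.exists_eigenfunction h₂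
  obtain ⟨χ₃, m₃, s₃, e₃, H₃⟩ := h.exists_eigenfunction h₃
  refine ⟨![χ₁, χ₂, χ₃], fun i => by fin_cases i; exacts [s₁, s₂, s₃], ?_⟩
  filter_upwards [H₁, H₂, H₃, eventually_ne_of_isConstOrId h₁ h₂ s₁ s₂ e₁ e₂ h₁₂,
    eventually_ne_of_isConstOrId h₁ h₃ s₁ s₃ e₁ e₃ h₁₃,
    eventually_ne_of_isConstOrId h₂ h₃ s₂ s₃ e₂ e₃ h₂₃] with x H₁ H₂ H₃ n₁₂ n₁₃ n₂₃
  generalize hL₁ : l₁ (χ₁ x) = L₁ at *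
  generalize hL₂ : l₂ (χ₂ x) = L₂ at *
  generalize hL₃ : l₃ (χ₃ x) = L₃ at *
  refine ⟨![m₁ x / ((L₁ - L₂) * (L₁ - L₃)), -m₂ x / ((L₁ - L₂) * (L₂ - L₃)),
    m₃ x / ((L₁ - L₃) * (L₂ - L₃))], fun t v => ?_⟩
  have H₁ := H₁ v
  have H₂ := H₂ v
  have H₃ := H₃ v
  simp only [pencil_apply] at H₁ H₂ H₃
  simp only [pencil_apply, Fin.sum_univ_three, Equation.formAt, coordMap, Matrix.cons_val, hL₁, hL₂,
    hL₃]
  rw [mul_assoc _ (m₁ x / _), mul_assoc _ (-m₂ x / _), mul_assoc _ (m₃ x / _),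
    div_mul_eq_mul_div, div_mul_eq_mul_div, div_mul_eq_mul_div, neg_mul, ← H₁, ← H₂, ← H₃]
  field_simp
  ring

/-- Hermite interpolation with a double node $L_2$ and a simple node $L_3$: the value and the
$t$-derivative at $L_2$ give the first two entries of $g$, the value at $L_3$ the last. -/
theorem IsIntegrablePencilNear.hasNormalForm_B (h : IsIntegrablePencilNear α p)
    {l₂ l₃ : ℝ → ℝ} {t₂ t₃ : ℝ} (h₂ : IsConstOrId l₂ t₂) (h₃ : IsConstOrId l₃ t₃)
    (h₂₃ : t₂ ≠ t₃) :
    ∃ χ : Fin 3 → E3 → ℝ, (∀ i, ∀ᶠ x in 𝓝 p, ContDiffAt ℝ ∞ (χ i) x) ∧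
      ∀ᶠ x in 𝓝 p, HasNormalFormAt (.B l₂ l₃) α χ x := by
  obtain ⟨χ, ψ, ρ, m, n, k, s₂, s₁, -, e₂, H₂⟩ := exists_eigenfunction_jets h.contDiffAt
    (h.integrable_prod t₂) (pencil_ne_zero h.linearIndependent t₂) h₂
  obtain ⟨χ₃, m₃, s₃, e₃, H₃⟩ := h.exists_eigenfunction h₃
  refine ⟨![ψ, χ, χ₃], fun i => by fin_cases i; exacts [s₁, s₂, s₃], ?_⟩
  filter_upwards [H₂, H₃, eventually_ne_of_isConstOrId h₃ h₂ s₃ s₂ e₃ e₂ h₂₃.symm]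
    with x H₂ H₃ n₂₃
  generalize hL₂ : l₂ (χ x) = L₂ at *
  generalize hL₃ : l₃ (χ₃ x) = L₃ at *
  refine ⟨![-m x / (L₃ - L₂), (-m x / (L₃ - L₂) - n x) / (L₃ - L₂), m₃ x / (L₃ - L₂) ^ 2],
    fun t v => ?_⟩
  obtain ⟨E₁, E₂, -⟩ := H₂ v
  have E₃ := H₃ v
  simp only [pencil_apply] at E₁ E₃
  simp only [pencil_apply, Fin.sum_univ_three, Equation.formAt, coordMap, Matrix.cons_val, hL₂,
    hL₃]
  field_simp
  linear_combination (t - L₂) ^ 2 * E₃ + ((L₃ - L₂) ^ 2 - (t - L₂) ^ 2) * E₁ +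
    ((L₃ - L₂) ^ 2 * (t - L₂) - (L₃ - L₂) * (t - L₂) ^ 2) * E₂

/-- With a triple node the interpolation is the Taylor expansion of $\alpha^t$ at $t=l_3(\chi)$,
whose three coefficients are the triangular expressions of `exists_eigenfunction_jets`. -/
theorem IsIntegrablePencilNear.hasNormalForm_C (h : IsIntegrablePencilNear α p)
    {l₃ : ℝ → ℝ} {t₃ : ℝ} (h₃ : IsConstOrId l₃ t₃) :
    ∃ χ : Fin 3 → E3 → ℝ, (∀ i, ∀ᶠ x in 𝓝 p, ContDiffAt ℝ ∞ (χ i) x) ∧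
      ∀ᶠ x in 𝓝 p, HasNormalFormAt (.C l₃) α χ x := by
  obtain ⟨χ, ψ, ρ, m, n, k, s₃, s₂, s₁, -, H⟩ := exists_eigenfunction_jets h.contDiffAt
    (h.integrable_prod t₃) (pencil_ne_zero h.linearIndependent t₃) h₃
  refine ⟨![ρ, ψ, χ], fun i => by fin_cases i; exacts [s₁, s₂, s₃], ?_⟩
  filter_upwards [H] with x H
  refine ⟨![m x * Real.exp (-(deriv l₃ (χ x) * ψ x)), n x, k x], fun t v => ?_⟩
  obtain ⟨E₁, E₂, E₃⟩ := H v
  have hexp : Real.exp (deriv l₃ (χ x) * ψ x) * Real.exp (-(deriv l₃ (χ x) * ψ x)) = 1 := by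
    rw [← Real.exp_add, add_neg_cancel, Real.exp_zero]
  simp only [pencil_apply] at E₁
  simp only [pencil_apply, Fin.sum_univ_three, Equation.formAt, coordMap, Matrix.cons_val]
  linear_combination E₁ + (t - l₃ (χ x)) * E₂ + (t - l₃ (χ x)) ^ 2 * E₃ +
    ((l₃ (χ x) - t) * m x * fderiv ℝ ψ x v - m x * fderiv ℝ χ x v) * hexp

end NormalForms

/-! ### Complexification of real-analytic functions -/

section Complexification

/-- The complexification of the model space. -/
abbrev C3 : Type := EuclideanSpace ℂ (Fin 3)

/-- The inclusion of the real points. -/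
def ofReal3 : E3 →L[ℝ] C3 :=
  LinearMap.toContinuousLinearMap
    { toFun := fun x => WithLp.toLp 2 fun i => (x i : ℂ)
      map_add' := fun x y => by ext i; simp
      map_smul' := fun c x => by ext i; simp }

/-- The real part. -/
def re3 : C3 →L[ℝ] E3 :=
  LinearMap.toContinuousLinearMap
    { toFun := fun z => WithLp.toLp 2 fun i => (z i).re
      map_add' := fun x y => by ext i; simp
      map_smul' := fun c x => by ext i; simp }

/-- The imaginary part. -/
def im3 : C3 →L[ℝ] E3 :=
  LinearMap.toContinuousLinearMap
    { toFun := fun z => WithLp.toLp 2 fun i => (z i).im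
      map_add' := fun x y => by ext i; simp
      map_smul' := fun c x => by ext i; simp }

@[simp] theorem ofReal3_apply (x : E3) (i : Fin 3) : ofReal3 x i = x i := rfl

@[simp] theorem re3_apply (z : C3) (i : Fin 3) : re3 z i = (z i).re := rfl

@[simp] theorem im3_apply (z : C3) (i : Fin 3) : im3 z i = (z i).im := rfl

theorem re3_ofReal3 (x : E3) : re3 (ofReal3 x) = x := by ext i; simp

theorem ofReal3_re3_add (z : C3) : ofReal3 (re3 z) + Complex.I • ofReal3 (im3 z) = z := by
  ext i
  simp [mul_comm Complex.I]

/-- The complexification of a real multilinear form. -/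
def complexifyMultilinear {n : ℕ} (f : E3 [×n]→L[ℝ] ℝ) : C3 [×n]→L[ℂ] ℂ :=
  ∑ r : Fin n → Fin 3, (f (fun k => EuclideanSpace.single (r k) 1) : ℂ) •
    (ContinuousMultilinearMap.mkPiAlgebra ℂ (Fin n) ℂ).compContinuousLinearMap
      fun k => (EuclideanSpace.proj (r k) : C3 →L[ℂ] ℂ)

/-- There are $3^n$ index words, each contributing a term of norm at most `‖f‖`. The geometric
growth costs only a factor 3 in the radius of convergence. -/
theorem norm_complexifyMultilinear_le {n : ℕ} (f : E3 [×n]→L[ℝ] ℝ) :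
    ‖complexifyMultilinear f‖ ≤ 3 ^ n * ‖f‖ := by
  have hproj (i : Fin 3) : ‖(EuclideanSpace.proj i : C3 →L[ℂ] ℂ)‖ ≤ 1 :=
    ContinuousLinearMap.opNorm_le_bound _ zero_le_one fun z => by
      simpa using PiLp.norm_apply_le z i
  have hterm (r : Fin n → Fin 3) : ‖(f (fun k => EuclideanSpace.single (r k) 1) : ℂ) •
      (ContinuousMultilinearMap.mkPiAlgebra ℂ (Fin n) ℂ).compContinuousLinearMap
        fun k => (EuclideanSpace.proj (r k) : C3 →L[ℂ] ℂ)‖ ≤ ‖f‖ := by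
    have h1 : ‖f fun k => EuclideanSpace.single (r k) 1‖ ≤ ‖f‖ := by
      simpa using f.le_opNorm fun k => EuclideanSpace.single (r k) (1 : ℝ)
    have h2 := ContinuousMultilinearMap.norm_compContinuousLinearMap_le
      (ContinuousMultilinearMap.mkPiAlgebra ℂ (Fin n) ℂ)
      fun k => (EuclideanSpace.proj (r k) : C3 →L[ℂ] ℂ)
    rw [ContinuousMultilinearMap.norm_mkPiAlgebra, one_mul] at h2
    have h3 := h2.trans (Finset.prod_le_one (fun _ _ => norm_nonneg _) fun k _ => hproj (r k))
    rw [norm_smul, Complex.norm_real]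
    exact (mul_le_mul h1 h3 (norm_nonneg _) (norm_nonneg _)).trans_eq (mul_one _)
  refine (norm_sum_le_of_le _ fun r _ => hterm r).trans_eq ?_
  simp

theorem complexifyMultilinear_ofReal3 {n : ℕ} (f : E3 [×n]→L[ℝ] ℝ) (v : Fin n → E3) :
    complexifyMultilinear f (fun k => ofReal3 (v k)) = f v := by
  have h1 : v = fun k => ∑ j, v k j • EuclideanSpace.single j (1 : ℝ) := by
    funext k
    conv_lhs => rw [← (EuclideanSpace.basisFun (Fin 3) ℝ).sum_repr (v k)]
    simp
  conv_rhs => rw [h1]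
  rw [f.map_sum, complexifyMultilinear, sum_apply, Complex.ofReal_sum]
  refine Finset.sum_congr rfl fun r _ => ?_
  rw [f.map_smul_univ (fun k => v k (r k)) fun k => EuclideanSpace.single (r k) (1 : ℝ)]
  simp [mul_comm]

theorem exists_complexification {f : E3 → ℝ} {p : E3} (hf : AnalyticAt ℝ f p) :
    ∃ F : C3 → ℂ, AnalyticAt ℂ F (ofReal3 p) ∧ ∀ᶠ x in 𝓝 p, F (ofReal3 x) = f x := by
  obtain ⟨P, hP⟩ := hf
  let Q : FormalMultilinearSeries ℂ C3 ℂ := fun n => complexifyMultilinear (P n)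
  obtain ⟨r, hr0, hr⟩ := ENNReal.lt_iff_exists_nnreal_btwn.1 hP.radius_pos
  obtain ⟨C, -, hC⟩ := P.norm_mul_pow_le_of_lt_radius hr
  have hQ : 0 < Q.radius := by
    refine lt_of_lt_of_le ?_ (Q.le_radius_of_bound (r := r / 3) C fun n => ?_)
    · exact_mod_cast div_pos (by exact_mod_cast hr0) (by norm_num : (0 : NNReal) < 3)
    · refine le_trans ?_ (hC n)
      have := norm_complexifyMultilinear_le (P n)
      calc ‖Q n‖ * ((r / 3 : NNReal) : ℝ) ^ n ≤ 3 ^ n * ‖P n‖ * ((r / 3 : NNReal) : ℝ) ^ n := by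
            gcongr
        _ = ‖P n‖ * (r : ℝ) ^ n := by
            rw [NNReal.coe_div, div_pow]
            simp
            field_simp
  have hsum := (Q.hasFPowerSeriesOnBall hQ).hasFPowerSeriesAt.comp_sub (ofReal3 p)
  rw [zero_add] at hsum
  refine ⟨fun z => Q.sum (z - ofReal3 p), ⟨Q, hsum⟩, ?_⟩
  filter_upwards [hP.eventually_hasSum_sub] with x hx
  have h1 : HasSum (fun n => Q n fun _ => ofReal3 x - ofReal3 p) (f x : ℂ) := by
    convert Complex.hasSum_ofReal.2 hx using 2 with n
    rw [← map_sub]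
    exact complexifyMultilinear_ofReal3 (P n) fun _ => x - p
  exact h1.tsum_eq

end Complexification

/-! ### Integrability of the complexified pencil -/

section ComplexPencil

theorem fderiv_pencil {𝕜 : Type*} [RCLike 𝕜] {E : Type*} [NormedAddCommGroup E] [NormedSpace 𝕜 E]
    {α : Fin 3 → E → E →L[𝕜] 𝕜} {x : E} (hα : ∀ i, DifferentiableAt 𝕜 (α i) x) (t : 𝕜) :
    fderiv 𝕜 (fun x => α 0 x + t • α 1 x + t ^ 2 • α 2 x) x =
      fderiv 𝕜 (α 0) x + t • fderiv 𝕜 (α 1) x + t ^ 2 • fderiv 𝕜 (α 2) x :=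
  (((hα 0).hasFDerivAt.add ((hα 1).hasFDerivAt.const_smul t)).add
    ((hα 2).hasFDerivAt.const_smul (t ^ 2))).fderiv

theorem differentiableAt_quadratic {𝕜 : Type*} [RCLike 𝕜] {F : Type*} [NormedAddCommGroup F]
    [NormedSpace 𝕜 F] {b : Fin 3 → 𝕜 → F} {T : 𝕜 → 𝕜} {ζ : 𝕜}
    (hb : ∀ i, DifferentiableAt 𝕜 (fun ζ => b i ζ) ζ) (hT : DifferentiableAt 𝕜 T ζ) :
    DifferentiableAt 𝕜 (fun ζ => b 0 ζ + T ζ • b 1 ζ + T ζ ^ 2 • b 2 ζ) ζ :=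
  ((hb 0).add (hT.smul (hb 1))).add ((hT.pow 2).smul (hb 2))

/-- The complex line through `z` and the real point `re z`. -/
def realLine (z : C3) (ζ : ℂ) : C3 := ofReal3 (re3 z) + ζ • ofReal3 (im3 z)

theorem realLine_I (z : C3) : realLine z Complex.I = z := ofReal3_re3_add z

theorem realLine_zero (z : C3) : realLine z 0 = ofReal3 (re3 z) := by simp [realLine]

theorem realLine_ofReal (z : C3) (s : ℝ) : realLine z s = ofReal3 (re3 z + s • im3 z) := by
  ext i
  simp [realLine]

theorem differentiable_realLine (z : C3) : Differentiable ℂ (realLine z) :=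
  (differentiable_const _).add (differentiable_id.smul_const _)

theorem convex_realLine_preimage (z : C3) {s : Set C3} (hs : Convex ℝ s) :
    Convex ℝ (realLine z ⁻¹' s) := by
  intro ζ hζ η hη a b ha hb hab
  have h : realLine z (a • ζ + b • η) = a • realLine z ζ + b • realLine z η := by
    have h1 : (a : ℂ) + b = 1 := by exact_mod_cast hab
    ext i
    simp [realLine]
    linear_combination (-((z i).re : ℂ)) * h1
  rw [Set.mem_preimage, h]
  exact hs hζ hη ha hb hab

theorem exists_complexification_form {α : E3 → E3 →L[ℝ] ℝ} {p : E3} (hα : AnalyticAt ℝ α p) :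
    ∃ A : C3 → C3 →L[ℂ] ℂ, (∀ᶠ z in 𝓝 (ofReal3 p), ContDiffAt ℂ ∞ A z) ∧
      ∀ᶠ x in 𝓝 p, ∀ v, A (ofReal3 x) (ofReal3 v) = α x v := by
  have h (i : Fin 3) : ∃ F : C3 → ℂ, AnalyticAt ℂ F (ofReal3 p) ∧
      ∀ᶠ x in 𝓝 p, F (ofReal3 x) = (α x (EuclideanSpace.single i 1) : ℝ) :=
    exists_complexification (((ContinuousLinearMap.apply ℝ ℝ
      (EuclideanSpace.single i (1 : ℝ) : E3)).analyticAt _).comp hα)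
  choose F hF hFα using h
  refine ⟨fun z => ∑ i, F i z • (EuclideanSpace.proj i : C3 →L[ℂ] ℂ), ?_, ?_⟩
  · filter_upwards [Filter.eventually_all.2 fun i => (hF i).eventually_analyticAt] with z hz
    exact ContDiffAt.sum fun i _ => (hz i).contDiffAt.smul contDiffAt_const
  · filter_upwards [Filter.eventually_all.2 hFα] with x hx v
    rw [eq_formOfComponents (α x), formOfComponents_apply]
    simp [hx]

theorem fderiv_complexification {α : E3 → E3 →L[ℝ] ℝ} {A : C3 → C3 →L[ℂ] ℂ} {x : E3}
    (hα : DifferentiableAt ℝ α x) (hA : DifferentiableAt ℂ A (ofReal3 x))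
    (h : ∀ᶠ x in 𝓝 x, ∀ v, A (ofReal3 x) (ofReal3 v) = α x v) (v w : E3) :
    fderiv ℂ A (ofReal3 x) (ofReal3 v) (ofReal3 w) = fderiv ℝ α x v w := by
  have h1 := ((hA.clm_apply (differentiableAt_const (ofReal3 w))).hasFDerivAt.restrictScalars ℝ).comp
    x ofReal3.hasFDerivAt
  have h2 := Complex.ofRealCLM.hasFDerivAt.comp x
    (hα.clm_apply (differentiableAt_const w)).hasFDerivAt
  have h3 := DFunLike.congr_fun
    (h1.unique (h2.congr_of_eventuallyEq (h.mono fun x hx => hx w))) v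
  change fderiv ℂ (fun z => A z (ofReal3 w)) (ofReal3 x) (ofReal3 v) =
    ((fderiv ℝ (fun x => α x w) x v : ℝ) : ℂ) at h3
  rwa [fderiv_apply_apply hA, fderiv_apply_apply hα] at h3

/-- Replace $z,t,u,v,w$ by their real part plus $\zeta$ times their imaginary part. The
integrability defect becomes a holomorphic function of $\zeta$ on a convex set; it vanishes for
small real $\zeta$, where all data are real, hence also at $\zeta=i$, where the original data
reappear. -/
theorem eventually_isIntegrableFormAt_complexification {α : Fin 3 → E3 → E3 →L[ℝ] ℝ}
    {A : Fin 3 → C3 → C3 →L[ℂ] ℂ} {p : E3} (hα : IsIntegrablePencilNear α p)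
    (hA : ∀ᶠ z in 𝓝 (ofReal3 p), ∀ i, ContDiffAt ℂ ∞ (A i) z)
    (h : ∀ᶠ x in 𝓝 p, ∀ i v, A i (ofReal3 x) (ofReal3 v) = α i x v) :
    ∀ᶠ z in 𝓝 (ofReal3 p), ∀ t : ℂ, IsIntegrableFormAt (fun z => pencil A (t, z)) z := by
  obtain ⟨r, hr, hB⟩ := Metric.eventually_nhds_iff_ball.1 hA
  set B := Metric.ball (ofReal3 p) r
  have hBo : IsOpen B := Metric.isOpen_ball
  have hre : Filter.Tendsto re3 (𝓝 (ofReal3 p)) (𝓝 p) := by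
    simpa [re3_ofReal3] using re3.continuous.tendsto (ofReal3 p)
  have hreB : ∀ᶠ z in 𝓝 (ofReal3 p), ofReal3 (re3 z) ∈ B :=
    hre.eventually (ofReal3.continuous.continuousAt.eventually (Metric.ball_mem_nhds _ hr))
  filter_upwards [Metric.ball_mem_nhds _ hr, hreB, hre.eventually
    (((hα.contDiffAt.and hα.integrable).and h).eventually_nhds)] with z hz hz' hN t u v w
  set S := realLine z ⁻¹' B
  have hS : IsOpen S := hBo.preimage (differentiable_realLine z).continuous
  let T : ℂ → ℂ := fun ζ => t.re + ζ * t.im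
  have hT : Differentiable ℂ T := by fun_prop
  let a : ℂ → C3 →L[ℂ] ℂ := fun ζ => A 0 (realLine z ζ) + T ζ • A 1 (realLine z ζ) +
    T ζ ^ 2 • A 2 (realLine z ζ)
  let D : ℂ → C3 →L[ℂ] C3 →L[ℂ] ℂ := fun ζ => fderiv ℂ (A 0) (realLine z ζ) +
    T ζ • fderiv ℂ (A 1) (realLine z ζ) + T ζ ^ 2 • fderiv ℂ (A 2) (realLine z ζ)
  let c : ℂ → C3 → C3 → C3 → ℂ := fun ζ u v w => a ζ u * (D ζ v w - D ζ w v)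
  let g : ℂ → ℂ := fun ζ => c ζ (realLine u ζ) (realLine v ζ) (realLine w ζ) +
    c ζ (realLine v ζ) (realLine w ζ) (realLine u ζ) +
    c ζ (realLine w ζ) (realLine u ζ) (realLine v ζ)
  have hdA {ζ : ℂ} (hζ : ζ ∈ S) (i : Fin 3) : DifferentiableAt ℂ (A i) (realLine z ζ) :=
    (hB _ hζ i).differentiableAt (by simp)
  have hda {ζ : ℂ} (hζ : ζ ∈ S) : DifferentiableAt ℂ a ζ := by
    have h1 (i) : DifferentiableAt ℂ (fun ζ => A i (realLine z ζ)) ζ :=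
      (hdA hζ i).comp ζ (differentiable_realLine z ζ)
    exact differentiableAt_quadratic h1 (hT ζ)
  have hdD {ζ : ℂ} (hζ : ζ ∈ S) : DifferentiableAt ℂ D ζ := by
    have h1 (i) : DifferentiableAt ℂ (fun ζ => fderiv ℂ (A i) (realLine z ζ)) ζ :=
      DifferentiableAt.comp ζ (((hB _ hζ i).fderiv_right (m := ∞) (by simp)).differentiableAt
        (by simp)) (differentiable_realLine z ζ)
    exact differentiableAt_quadratic (F := C3 →L[ℂ] C3 →L[ℂ] ℂ)
      (b := fun i ζ => fderiv ℂ (A i) (realLine z ζ)) h1 (hT ζ)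
  have hdc {ζ : ℂ} (hζ : ζ ∈ S) (u v w : C3) :
      DifferentiableAt ℂ (fun ζ => c ζ (realLine u ζ) (realLine v ζ) (realLine w ζ)) ζ := by
    have hl (u) := differentiable_realLine u ζ
    exact ((hda hζ).clm_apply (hl u)).mul ((((hdD hζ).clm_apply (hl v)).clm_apply (hl w)).sub
      (((hdD hζ).clm_apply (hl w)).clm_apply (hl v)))
  have hg : AnalyticOnNhd ℂ g S := DifferentiableOn.analyticOnNhd (fun ζ hζ =>
    (((hdc hζ u v w).add (hdc hζ v w u)).add (hdc hζ w u v)).differentiableWithinAt) hS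
  have h0 : (0 : ℂ) ∈ S := by
    rw [Set.mem_preimage, realLine_zero]
    exact hz'
  have hreal : ∀ᶠ s : ℝ in 𝓝 0, g s = 0 := by
    have h1 : Filter.Tendsto (fun s : ℝ => re3 z + s • im3 z) (𝓝 0) (𝓝 (re3 z)) := by
      have : Continuous fun s : ℝ => re3 z + s • im3 z := by fun_prop
      simpa using this.tendsto 0
    have h2 : ∀ᶠ s : ℝ in 𝓝 0, (s : ℂ) ∈ S :=
      Complex.continuous_ofReal.continuousAt.eventually (by simpa using hS.mem_nhds h0)
    filter_upwards [h1.eventually hN.eventually_nhds, h2] with s hs hsS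
    set x := re3 z + s • im3 z
    have hx : realLine z s = ofReal3 x := realLine_ofReal z s
    obtain ⟨⟨hαx, hintx⟩, hx'⟩ := hs.self_of_nhds
    have hαd (i) : DifferentiableAt ℝ (α i) x := (hαx i).differentiableAt (by simp)
    have hTs : T s = ((t.re + s * t.im : ℝ) : ℂ) := by simp [T]
    set t' := t.re + s * t.im
    have ha (v : E3) : a s (ofReal3 v) = (pencil α (t', x) v : ℝ) := by
      simp [a, hx, hTs, hx', pencil]
    have hD (v w : E3) : D s (ofReal3 v) (ofReal3 w) =
        (fderiv ℝ (fun x => pencil α (t', x)) x v w : ℝ) := by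
      have h3 (i) := fderiv_complexification (hαd i) (hx ▸ hdA hsS i)
        (hs.mono fun x hx => hx.2 i) v w
      have h4 : fderiv ℝ (fun x => pencil α (t', x)) x = _ := fderiv_pencil hαd t'
      rw [h4]
      simp [D, hx, hTs, h3]
    have h5 := hintx t' (re3 u + s • im3 u) (re3 v + s • im3 v) (re3 w + s • im3 w)
    simp only [g, c, realLine_ofReal, ha, hD]
    exact_mod_cast h5
  have hfreq : ∃ᶠ ζ in 𝓝[≠] (0 : ℂ), g ζ = 0 := by
    have h1 : Filter.Tendsto (fun s : ℝ => (s : ℂ)) (𝓝[≠] 0) (𝓝[≠] 0) := by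
      refine tendsto_nhdsWithin_iff.2 ⟨?_, ?_⟩
      · simpa using (Complex.continuous_ofReal.tendsto 0).mono_left nhdsWithin_le_nhds
      · filter_upwards [self_mem_nhdsWithin] with s hs
        simpa using hs
    exact h1.frequently (hreal.filter_mono nhdsWithin_le_nhds).frequently
  have hI : Complex.I ∈ S := by
    rw [Set.mem_preimage, realLine_I]
    exact hz
  have hgI := hg.eqOn_zero_of_preconnected_of_frequently_eq_zero
    (convex_realLine_preimage z (convex_ball _ _)).isPreconnected h0 hfreq hI
  have hTI : T Complex.I = t := by
    simp only [T]
    rw [mul_comm, Complex.re_add_im]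
  have hdz : fderiv ℂ (fun z => pencil A (t, z)) z = D Complex.I := by
    simp only [D, realLine_I, hTI]
    exact fderiv_pencil (fun i => (hB z hz i).differentiableAt (by simp)) t
  have haz : pencil A (t, z) = a Complex.I := by
    simp only [a, realLine_I, hTI]
    rfl
  simp only [g, c, realLine_I, ← hdz, ← haz] at hgI
  exact hgI

end ComplexPencil

/-! ### Normal forms of type D -/

section NormalFormD

/-- Interpolation at $z,\bar z$ and a real node. On real points $\alpha^z=\mu\,(dx_1+i\,dx_2)$ for
the complex eigenfunction $x_1+ix_2$; its conjugate is the value at $\bar z$, so the real and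
imaginary parts of one relation serve both nodes. -/
theorem IsIntegrablePencilNear.hasNormalForm_D {α : Fin 3 → E3 → E3 →L[ℝ] ℝ} {p : E3}
    (h : IsIntegrablePencilNear α p) (hα : ∀ i, AnalyticAt ℝ (α i) p) {l : ℂ → ℂ} {c : ℂ}
    (hl : IsConstOrId l c) (hc : c.im ≠ 0) {l₃ : ℝ → ℝ} {t₃ : ℝ} (h₃ : IsConstOrId l₃ t₃) :
    ∃ χ : Fin 3 → E3 → ℝ, (∀ i, ∀ᶠ x in 𝓝 p, ContDiffAt ℝ ∞ (χ i) x) ∧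
      ∀ᶠ x in 𝓝 p, HasNormalFormAt
        (.D (fun s r => (l ⟨s, r⟩).re) (fun s r => (l ⟨s, r⟩).im) l₃) α χ x := by
  choose A hA hAα using fun i => exists_complexification_form (hα i)
  have hA' := Filter.eventually_all.2 hA
  have hAα' := Filter.eventually_all.2 hAα
  have hint := eventually_isIntegrableFormAt_complexification h hA' hAα'
  have hres {x : E3} (hx : ∀ i v, A i (ofReal3 x) (ofReal3 v) = α i x v) (t : ℂ) (v : E3) :
      pencil A (t, ofReal3 x) (ofReal3 v) = α 0 x v + t * α 1 x v + t ^ 2 * α 2 x v := by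
    simp [pencil_apply, hx]
  have hne : pencil A (c, ofReal3 p) ≠ 0 := by
    intro h0
    -- On real vectors the imaginary part of $\alpha^c$ is
    -- $\operatorname{Im}c\,(\alpha_1+2\operatorname{Re}c\,\alpha_2)$.
    have h1 (v : E3) : α 1 p v + 2 * c.re * α 2 p v = 0 := by
      have h2 := hres hAα'.self_of_nhds c v
      rw [h0] at h2
      have h3 := congrArg Complex.im h2
      simp [sq] at h3
      refine (mul_eq_zero.1 ?_).resolve_left hc
      linear_combination -h3
    have h4 := Fintype.linearIndependent_iff.1 h.linearIndependent ![0, 1, 2 * c.re]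
      (by
        ext v : 1
        simpa [Fin.sum_univ_three] using h1 v) 1
    simp at h4
  obtain ⟨χ, m, hχ, hχp, H⟩ := Veronese.exists_eigenfunction hA'
    ((continuousAt_snd.eventually hint).mono fun q hq => hq q.1) hne hl
  obtain ⟨χ₃, m₃, s₃, -, H₃⟩ := h.exists_eigenfunction h₃
  have hι : Filter.Tendsto ofReal3 (𝓝 p) (𝓝 (ofReal3 p)) := ofReal3.continuous.tendsto p
  have hsm : ∀ᶠ x in 𝓝 p, ContDiffAt ℝ ∞ (fun x => χ (ofReal3 x)) x :=
    (hι.eventually hχ).mono fun x hx => (hx.restrict_scalars ℝ).comp x ofReal3.contDiff.contDiffAt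
  have hlc : ContinuousAt (fun x => (l (χ (ofReal3 x))).im) p := by
    have h1 : Continuous l := by
      rcases hl with rfl | rfl
      exacts [continuous_const, continuous_id]
    exact Complex.continuous_im.continuousAt.comp
      (h1.continuousAt.comp hsm.self_of_nhds.continuousAt)
  have him : ∀ᶠ x in 𝓝 p, (l (χ (ofReal3 x))).im ≠ 0 :=
    hlc.eventually_ne (by rwa [hχp])
  refine ⟨![fun x => (χ (ofReal3 x)).re, fun x => (χ (ofReal3 x)).im, χ₃], fun i => ?_, ?_⟩
  · fin_cases i
    · exact hsm.mono fun x hx => Complex.reCLM.contDiff.contDiffAt.comp x hx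
    · exact hsm.mono fun x hx => Complex.imCLM.contDiff.contDiffAt.comp x hx
    · exact s₃
  filter_upwards [hι.eventually H, hι.eventually hχ, H₃, hAα', him] with x H hχx H₃ hx hb
  have hd : HasFDerivAt (fun x => χ (ofReal3 x))
      (((fderiv ℂ χ (ofReal3 x)).restrictScalars ℝ).comp ofReal3) x :=
    ((hχx.differentiableAt (by simp)).hasFDerivAt.restrictScalars ℝ).comp x ofReal3.hasFDerivAt
  have hX : fderiv ℝ (fun x => (χ (ofReal3 x)).re) x = _ :=
    (Complex.reCLM.hasFDerivAt.comp x hd).fderiv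
  have hY : fderiv ℝ (fun x => (χ (ofReal3 x)).im) x = _ :=
    (Complex.imCLM.hasFDerivAt.comp x hd).fderiv
  generalize hL₃ : l₃ (χ₃ x) = t at *
  generalize hL : l (χ (ofReal3 x)) = z at *
  generalize hM : m (ofReal3 x) = μ at *
  have hN : z.im ^ 2 + (t - z.re) ^ 2 ≠ 0 := by positivity
  have hN' : (z.re - t) ^ 2 + z.im ^ 2 ≠ 0 := by positivity
  -- At $\tau=z$ the form of type D is $-i\operatorname{Im}z\,(t-z)(g_1-ig_2)(dx_1+i\,dx_2)$;
  -- equating the coefficient with $\mu$ gives $g_1,g_2$, and $\tau=t$ gives $g_3$.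
  refine ⟨![-(μ.re * z.im + μ.im * (t - z.re)) / (z.im * (z.im ^ 2 + (t - z.re) ^ 2)),
    (μ.im * z.im - μ.re * (t - z.re)) / (z.im * (z.im ^ 2 + (t - z.re) ^ 2)),
    m₃ x / (z.im ^ 2 + (t - z.re) ^ 2)], fun τ v => ?_⟩
  have E := H (ofReal3 v)
  rw [hres hx] at E
  have E₁ := congrArg Complex.re E
  have E₂ := congrArg Complex.im E
  have E₃ := H₃ v
  have hXv : fderiv ℝ (fun x => (χ (ofReal3 x)).re) x v =
      (fderiv ℂ χ (ofReal3 x) (ofReal3 v)).re := by rw [hX]; rfl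
  have hYv : fderiv ℝ (fun x => (χ (ofReal3 x)).im) x v =
      (fderiv ℂ χ (ofReal3 x) (ofReal3 v)).im := by rw [hY]; rfl
  simp [sq] at E₁ E₂
  simp only [pencil_apply] at E₃
  simp only [pencil_apply, Fin.sum_univ_three, Equation.formAt, coordMap, Matrix.cons_val, hL₃,
    Complex.eta, hL, hXv, hYv]
  refine mul_left_cancel₀ (mul_ne_zero hb hN) ?_
  field_simp
  linear_combination (z.im * (z.im ^ 2 + (t - z.re) ^ 2) - z.im * ((τ - z.re) ^ 2 + z.im ^ 2)) * E₁ +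
    ((τ - z.re) * (z.im ^ 2 + (t - z.re) ^ 2) - (t - z.re) * ((τ - z.re) ^ 2 + z.im ^ 2)) * E₂ +
    z.im * ((τ - z.re) ^ 2 + z.im ^ 2) * E₃

end NormalFormD

/-! ### Assembly over the fourteen types. -/

section Main

variable {M : Type*} [TopologicalSpace M] [ChartedSpace E3 M] [IsManifold (𝓡 3) ∞ M] {W : Web M}
  {p : M}

/-- Near `p` there are coordinates in which all first integrals of `F_∞` are nondegenerate solutions
of the equation `Q`. -/
def Web.HasSolutionChartAt (W : Web M) (Q : Equation) (p : M) : Prop :=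
  ∃ φ ∈ IsManifold.maximalAtlas (𝓡 3) ∞ M, p ∈ φ.source ∧
    ∀ V : Set M, IsOpen V → V ⊆ φ.source →
      ∀ f : M → ℝ, (W.foliation OnePoint.infty).IsFirstIntegralOn f V →
        Q.IsNondegenerateSolutionOn (f ∘ φ.symm) (φ '' V)

theorem Web.hasSolutionChartAt_of_normalForm (W : Web M) (p : M) {Q : Equation} (hQ : Q.IsRegular)
    (H : ∀ (α : Fin 3 → E3 → E3 →L[ℝ] ℝ) (y : E3), IsIntegrablePencilNear α y →
      ∃ χ : Fin 3 → E3 → ℝ, (∀ i, ∀ᶠ x in 𝓝 y, ContDiffAt ℝ ∞ (χ i) x) ∧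
        ∀ᶠ x in 𝓝 y, HasNormalFormAt Q α χ x) : W.HasSolutionChartAt Q p := by
  obtain ⟨φ, hφ, hp, α, hα⟩ := W.exists_coframe p
  obtain ⟨χ, hχ, H⟩ := H α _ (hα.isIntegrablePencilNear hφ hp le_rfl)
  exact exists_chart_of_hasNormalForm W hQ hφ hp hα hχ H

theorem Web.IsAnalyticNear.hasSolutionChartAt (h : W.IsAnalyticNear p) {l : ℂ → ℂ} {c : ℂ}
    (hl : IsConstOrId l c) (hc : c.im ≠ 0) {l₃ : ℝ → ℝ} {t₃ : ℝ} (h₃ : IsConstOrId l₃ t₃)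
    {Q : Equation} (hQ : Q.IsRegular)
    (hQD : Q = .D (fun s r => (l ⟨s, r⟩).re) (fun s r => (l ⟨s, r⟩).im) l₃) :
    W.HasSolutionChartAt Q p := by
  obtain ⟨φ, hφ, hp, α, hα⟩ := h
  obtain ⟨χ, hχ, H⟩ := (hα.isIntegrablePencilNear hφ hp le_top).hasNormalForm_D
    (fun i => ((hα.contDiffOn i).contDiffAt
      (φ.open_target.mem_nhds (φ.map_source hp))).analyticAt) hl hc h₃
  rw [← hQD] at H
  exact exists_chart_of_hasNormalForm W hQ hφ hp hα hχ H

theorem Web.hasSolutionChartAt (W : Web M) (X : EqType) (p : M)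
    (hD : X.IsTypeD → W.IsAnalyticNear p) : W.HasSolutionChartAt X.equation p := by
  have hc (t : ℝ) : IsConstOrId (fun _ : ℝ => t) t := Or.inl rfl
  have hi (t : ℝ) : IsConstOrId (fun s : ℝ => s) t := Or.inr rfl
  have sc (t : ℝ) : ContDiff ℝ ∞ (fun _ : ℝ => t) := contDiff_const
  have si : ContDiff ℝ ∞ (fun s : ℝ => s) := contDiff_id
  have key := @Web.hasSolutionChartAt_of_normalForm M _ _ _ W p
  match X, hD with
  | .A0, _ =>
    exact key ⟨si, si, si⟩ fun α y h =>
      -- The value of a moving node at `p` is free, so any numbers distinct from each other and from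
      -- the constant nodes will do, here and in the cases below.
      h.hasNormalForm_A (hi 0) (hi 1) (hi 2) (by norm_num) (by norm_num) (by norm_num)
  | .A1 c₃, _ =>
    exact key ⟨si, si, sc c₃⟩ fun α y h =>
      h.hasNormalForm_A (hi (c₃ + 1)) (hi (c₃ + 2)) (hc c₃) (by norm_num) (by norm_num)
        (by norm_num)
  | .A2 c₂ c₃ h₂₃, _ =>
    obtain ⟨t, ht⟩ := Infinite.exists_notMem_finset ({c₂, c₃} : Finset ℝ)
    simp only [Finset.mem_insert, Finset.mem_singleton, not_or] at ht
    exact key ⟨si, sc c₂, sc c₃⟩ fun α y h =>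
      h.hasNormalForm_A (hi t) (hc c₂) (hc c₃) ht.1 ht.2 h₂₃
  | .A3 c₁ c₂ c₃ h₁₂ h₁₃ h₂₃, _ =>
    exact key ⟨sc c₁, sc c₂, sc c₃⟩ fun α y h =>
      h.hasNormalForm_A (hc c₁) (hc c₂) (hc c₃) h₁₂ h₁₃ h₂₃
  | .B0, _ =>
    exact key ⟨si, si⟩ fun α y h => h.hasNormalForm_B (hi 0) (hi 1) (by norm_num)
  | .B1 c₃, _ =>
    exact key ⟨si, sc c₃⟩ fun α y h =>
      h.hasNormalForm_B (hi (c₃ + 1)) (hc c₃) (by norm_num)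
  | .B2 c₂, _ =>
    exact key ⟨sc c₂, si⟩ fun α y h =>
      h.hasNormalForm_B (hc c₂) (hi (c₂ + 1)) (by norm_num)
  | .B3 c₂ c₃ h₂₃, _ =>
    exact key ⟨sc c₂, sc c₃⟩ fun α y h =>
      h.hasNormalForm_B (hc c₂) (hc c₃) h₂₃
  | .C0, _ =>
    exact key (Q := .C _) si fun α y h => h.hasNormalForm_C (hi 0)
  | .C1 c₃, _ =>
    exact key (Q := .C _) (sc c₃) fun α y h => h.hasNormalForm_C (hc c₃)
  | .D0, hD =>
    -- Any nonreal number can be the value at `p` of a moving complex node.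
    exact (hD trivial).hasSolutionChartAt (l := fun s => s) (c := Complex.I) (Or.inr rfl) (by simp)
      (hi 0) ⟨si, Or.inr ⟨rfl, rfl⟩⟩ rfl
  | .D1 c₃, hD =>
    exact (hD trivial).hasSolutionChartAt (l := fun s => s) (c := Complex.I) (Or.inr rfl) (by simp)
      (hc c₃) ⟨sc c₃, Or.inr ⟨rfl, rfl⟩⟩ rfl
  | .D2 c₁ c₂ h₂, hD =>
    exact (hD trivial).hasSolutionChartAt (l := fun _ => ⟨c₁, c₂⟩) (c := ⟨c₁, c₂⟩) (Or.inl rfl) h₂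
      (hi 0) ⟨si, Or.inl ⟨c₁, c₂, rfl, rfl⟩⟩ rfl
  | .D3 c₁ c₂ c₃ h₂, hD =>
    exact (hD trivial).hasSolutionChartAt (l := fun _ => ⟨c₁, c₂⟩) (c := ⟨c₁, c₂⟩) (Or.inl rfl) h₂
      (hc c₃) ⟨sc c₃, Or.inl ⟨c₁, c₂, rfl, rfl⟩⟩ rfl

end Main

end Veronese

end

theorem mainTheorem5 {M : Type*} [TopologicalSpace M]
    [ChartedSpace (EuclideanSpace ℝ (Fin 3)) M] [IsManifold (𝓡 3) ∞ M]
    (W : Veronese.Web M) (X : Veronese.EqType) (p : M)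
    (hD : X.IsTypeD → W.IsAnalyticNear p) :
    ∃ φ ∈ IsManifold.maximalAtlas (𝓡 3) ∞ M, p ∈ φ.source ∧
      ∀ V : Set M, IsOpen V → V ⊆ φ.source →
        ∀ f : M → ℝ, (W.foliation OnePoint.infty).IsFirstIntegralOn f V →
          X.equation.IsNondegenerateSolutionOn (f ∘ φ.symm) (φ '' V) :=
  W.hasSolutionChartAt X p hD
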